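/- Let $B=\{B_s\}_{s\ge 0}$ be a standard real Brownian motion on a probability space $(\Omega,\mathcal F,P)$, let $\{\mathcal F_s\}_{s\ge0}$ be the filtration generated by $B$, and let $p_s(x)=\frac{1}{\sqrt{2\pi s}}e^{-x^2/(2s)}$, $s>0$, be the heat kernel. Fix $t>0$ and put, for $h>0$ and $0\le r<t$, $$\hat u_{t,h}(r)=4\int_0^r\int_0^h\big(p_{t-r}(B_r-B_u+\eta)-p_{t-r}(B_r-B_u-\eta)\big)\,d\eta\,du .$$ Then there is a constant $C>0$, which does not depend on $h$, such that for all $h>0$ the process $\hat u_{t,h}$ belongs to $L^2(\Omega\times[0,t])$ and $$\mathbb E\left(\int_0^t|\hat u_{t,h}(r)|^2\,dr\right)\le C h^4 .$$ Moreover, for every $h>0$ the Itô integral $\int_0^t\hat u_{t,h}(r)\,dB_r$ (the $L^2(\Omega)$-limit of the elementary stochastic integrals of simple $\{\mathcal F_s\}$-adapted processes converging to $\hat u_{t,h}$ in $L^2(\Omega\times[0,t])$) exists, and $$h^{-3/2}\int_0^t\hat u_{t,h}(r)\,dB_r\longrightarrow 0\quad\text{in }L^2(\Omega)\text{ as }h\downarrow0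 .$$ -/

import Mathlib

open MeasureTheory ProbabilityTheory Filter
open scoped NNReal ENNReal Topology

namespace LocalTimeModulus

/-- The heat kernel `p_s(x) = (2 π s)^(-1/2) exp (-x² / (2 s))`, used for `s > 0`. -/
noncomputable def heatKernel (s x : ℝ) : ℝ :=
  (√(2 * Real.pi * s))⁻¹ * Real.exp (-x ^ 2 / (2 * s))

/-- The heat-kernel part of the Clark-Ocone integrand of the `L²`-modulus of continuity of the
Brownian local time, for `0 ≤ r < t` and `h > 0`:
`4 ∫_0^r ∫_0^h (p_{t-r}(B_r - B_u + η) - p_{t-r}(B_r - B_u - η)) dη du`. -/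
noncomputable def uHat {Ω : Type*} (B : ℝ≥0 → Ω → ℝ) (t : ℝ≥0) (h r : ℝ) (ω : Ω) : ℝ :=
  4 * ∫ u in (0 : ℝ)..r, ∫ η in (0 : ℝ)..h,
    (heatKernel (t - r) (B r.toNNReal ω - B u.toNNReal ω + η)
      - heatKernel (t - r) (B r.toNNReal ω - B u.toNNReal ω - η))

/-- A simple process adapted to the filtration `𝓕`:
`V_s = ∑_{i < n} ξ_i 1_{(t_i, t_{i+1}]}(s)` with `0 ≤ t_0 ≤ t_1 ≤ ⋯` and each `ξ_i` bounded and
`𝓕_{t_i}`-measurable. (Only the times `t_0, …, t_n` and the coefficients `ξ_0, …, ξ_{n-1}`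
matter.) -/
structure SimpleProcess {Ω : Type*} {mΩ : MeasurableSpace Ω} (𝓕 : Filtration ℝ≥0 mΩ) where
  /-- The number of steps. -/
  n : ℕ
  /-- The partition points. -/
  time : ℕ → ℝ≥0
  /-- The coefficients. -/
  coeff : ℕ → Ω → ℝ
  time_mono : Monotone time
  coeff_meas : ∀ i, StronglyMeasurable[𝓕 (time i)] (coeff i)
  coeff_bdd : ∀ i, ∃ K : ℝ, ∀ ω, |coeff i ω| ≤ K

namespace SimpleProcess

variable {Ω : Type*} {mΩ : MeasurableSpace Ω} {𝓕 : Filtration ℝ≥0 mΩ}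

/-- The value of the simple process `V` at time `s`. -/
noncomputable def eval (V : SimpleProcess 𝓕) (s : ℝ) (ω : Ω) : ℝ :=
  ∑ i ∈ Finset.range V.n,
    (Set.Ioc (V.time i : ℝ) (V.time (i + 1) : ℝ)).indicator (fun _ => V.coeff i ω) s

/-- The elementary stochastic integral `∫_0^t V_s dB_s` of a simple process:
`∑_{i < n} ξ_i (B_{t_{i+1} ∧ t} - B_{t_i ∧ t})`. -/
noncomputable def integral (V : SimpleProcess 𝓕) (B : ℝ≥0 → Ω → ℝ) (t : ℝ≥0) (ω : Ω) : ℝ :=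
  ∑ i ∈ Finset.range V.n,
    V.coeff i ω * (B (min (V.time (i + 1)) t) ω - B (min (V.time i) t) ω)

end SimpleProcess

/-- `X` is (a version of) the Itô integral `∫_0^t u_r dB_r`, where `B` is a Brownian motion for
the filtration `𝓕`: the process `u` is the limit in `L²(Ω × [0, t])` of simple adapted processes
whose elementary stochastic integrals converge to `X` in `L²(Ω)`. -/
def IsItoIntegral {Ω : Type*} {mΩ : MeasurableSpace Ω} (𝓕 : Filtration ℝ≥0 mΩ)
    (B : ℝ≥0 → Ω → ℝ) (P : Measure Ω) (t : ℝ≥0) (u : ℝ → Ω → ℝ) (X : Ω → ℝ) : Prop :=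
  MemLp (fun p : Ω × ℝ => u p.2 p.1) 2 (P.prod (volume.restrict (Set.Icc 0 (t : ℝ)))) ∧
  MemLp X 2 P ∧
  ∃ V : ℕ → SimpleProcess 𝓕,
    Tendsto (fun k => eLpNorm (fun p : Ω × ℝ => (V k).eval p.2 p.1 - u p.2 p.1) 2
      (P.prod (volume.restrict (Set.Icc 0 (t : ℝ))))) atTop (𝓝 0) ∧
    Tendsto (fun k => eLpNorm (fun ω => (V k).integral B t ω - X ω) 2 P) atTop (𝓝 0)

end LocalTimeModulus

namespace LocalTimeModulus

/-! ### Estimates for the heat kernel -/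

/-! Write k_s(x) = ∫_0^h (p_s(x+η) - p_s(x-η)) dη (`kernelDiff`) and s = t - r. Expanding the
square, E|û(r)|² is 16 times the integral over u, v ∈ (0, r] of E[k_s(B_r - B_u) k_s(B_r - B_v)].
The claim is that this covariance is at most h⁴ times a product of power singularities, each of
exponent less than 1. For u < v < r put X = B_r - B_v and Y = B_v - B_u, which are independent
Gaussians. The expectation is E[k_s(X) g(X)] with g(x) = E k_s(x + Y), and each factor contributes
h². The factor k_s(X) is measured in L¹: ‖k_s‖_{L¹(dx)} ≤ 4h² s^(-1/2), and X has density at most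
(r-v)^(-1/2) (`lintegral_enorm_kernelDiff_gaussianReal_le`). The factor g is measured in sup norm: a
symmetric increment of an L-Lipschitz function integrates to at most 2h²L, and p_s smoothed by Y has
Lipschitz constant at most both 1/s and 1/(v-u). Interpolation gives |g| ≤ 2h² s^(-1/4) (v-u)^(-3/4)
(`abs_integral_kernelDiff_gaussianReal_le_rpow`). The product 8h⁴ s^(-3/4) (r-v)^(-1/2) (v-u)^(-3/4)
(`enorm_integral_kernelDiff_mul_le_of_lt`) is integrable in u, v and r, which yields C h⁴.

For the stochastic integral, û cut off at T < t is a path integral of a bounded continuous function,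
hence an L² limit of left Riemann sums, which are simple adapted processes; letting T ↑ t puts û in
their closure. The Itô isometry, proved here for the generated filtration, gives existence by
completeness and shows that the norm of the integral is at most √C h². Multiplication by h^(-3/2)
leaves √C h^(1/2). -/

lemma heatKernel_eq_gaussianPDFReal {s : ℝ} (hs : 0 < s) (x : ℝ) :
    heatKernel s x = gaussianPDFReal 0 s.toNNReal x := by
  simp [heatKernel, gaussianPDFReal, hs.le]

lemma heatKernel_nonneg (s x : ℝ) : 0 ≤ heatKernel s x := by
  unfold heatKernel; positivity

lemma heatKernel_le {s : ℝ} (hs : 0 < s) (x : ℝ) : heatKernel s x ≤ (√s)⁻¹ := by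
  have h1 : √s ≤ √(2 * Real.pi * s) := Real.sqrt_le_sqrt (by nlinarith [Real.pi_gt_three])
  have h2 : Real.exp (-x ^ 2 / (2 * s)) ≤ 1 := by
    rw [Real.exp_le_one_iff]
    exact div_nonpos_of_nonpos_of_nonneg (by nlinarith [sq_nonneg x]) (by positivity)
  have h3 : 0 < √s := Real.sqrt_pos.2 hs
  calc heatKernel s x ≤ (√(2 * Real.pi * s))⁻¹ * 1 := by unfold heatKernel; gcongr
    _ ≤ (√s)⁻¹ := by rw [mul_one]; gcongr

@[fun_prop]
lemma measurable_heatKernel : Measurable (fun p : ℝ × ℝ => heatKernel p.1 p.2) := by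
  unfold heatKernel; fun_prop

lemma continuous_heatKernel {α : Type*} [TopologicalSpace α] {f g : α → ℝ} (hf : Continuous f)
    (hg : Continuous g) (h0 : ∀ a, 0 < f a) : Continuous (fun a => heatKernel (f a) (g a)) := by
  unfold heatKernel
  refine Continuous.mul (Continuous.inv₀ (by fun_prop) fun a => ?_)
    (Real.continuous_exp.comp (Continuous.div (by fun_prop) (by fun_prop) fun a => ?_))
  · have := h0 a
    have := Real.pi_pos
    positivity
  · have := h0 a
    positivity

lemma integrable_heatKernel {s : ℝ} (hs : 0 < s) : Integrable (heatKernel s) := by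
  rw [show heatKernel s = gaussianPDFReal 0 s.toNNReal from
    funext (heatKernel_eq_gaussianPDFReal hs)]
  exact integrable_gaussianPDFReal _ _

lemma integral_heatKernel {s : ℝ} (hs : 0 < s) : ∫ x, heatKernel s x = 1 := by
  simp_rw [heatKernel_eq_gaussianPDFReal hs]
  exact integral_gaussianPDFReal_eq_one _ (by simpa using hs)

lemma lintegral_heatKernel {s : ℝ} (hs : 0 < s) :
    ∫⁻ x, ENNReal.ofReal (heatKernel s x) = 1 := by
  simp_rw [heatKernel_eq_gaussianPDFReal hs]
  exact lintegral_gaussianPDFReal_eq_one _ (by simpa using hs)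

lemma hasDerivAt_heatKernel (s x : ℝ) :
    HasDerivAt (heatKernel s) (-(x / s) * heatKernel s x) x := by
  have h1 : HasDerivAt (fun x : ℝ => -x ^ 2 / (2 * s)) (-(2 * x) / (2 * s)) x := by
    simpa using ((hasDerivAt_pow 2 x).neg.div_const (2 * s))
  have h2 := (h1.exp).const_mul (√(2 * Real.pi * s))⁻¹
  refine h2.congr_deriv ?_
  unfold heatKernel
  rw [show -(2 * x) / (2 * s) = -(x / s) by rw [← mul_neg, mul_div_mul_left _ _ two_ne_zero, neg_div]]
  ring

lemma abs_mul_exp_le (y : ℝ) : |y| * Real.exp (-y ^ 2 / 2) ≤ 1 := by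
  have h1 : |y| ≤ Real.exp (y ^ 2 / 2) := by
    have := Real.add_one_le_exp (y ^ 2 / 2)
    nlinarith [sq_abs y, sq_nonneg (|y| - 1)]
  calc |y| * Real.exp (-y ^ 2 / 2) ≤ Real.exp (y ^ 2 / 2) * Real.exp (-y ^ 2 / 2) := by gcongr
    _ = 1 := by rw [← Real.exp_add]; ring_nf; simp

/-- The spatial derivative of the heat kernel is controlled by the kernel at twice the time. -/
lemma abs_deriv_heatKernel_le_heatKernel {s : ℝ} (hs : 0 < s) (x : ℝ) :
    |-(x / s) * heatKernel s x| ≤ 2 * (√s)⁻¹ * heatKernel (2 * s) x := by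
  have h0 : 0 < √s := Real.sqrt_pos.2 hs
  have hsq : √s * √s = s := Real.mul_self_sqrt hs.le
  have h2 : √(2 : ℝ) * √2 = 2 := Real.mul_self_sqrt (by norm_num)
  have h20 : 0 < √(2 : ℝ) := by positivity
  -- Half of the Gaussian exponent stays in the kernel at time 2s; the other half absorbs the factor
  -- |x|.
  have e1 : heatKernel s x = √2 * heatKernel (2 * s) x * Real.exp (-(x / √(2 * s)) ^ 2 / 2) := by
    have hpi := Real.pi_pos
    unfold heatKernel
    rw [show 2 * Real.pi * (2 * s) = 2 * (2 * Real.pi * s) by ring,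
      Real.sqrt_mul (by norm_num : (0 : ℝ) ≤ 2) (2 * Real.pi * s), mul_inv,
      ← mul_assoc, ← mul_assoc, mul_inv_cancel₀ h20.ne', one_mul,
      mul_assoc _ (Real.exp _) (Real.exp _), ← Real.exp_add,
      div_pow, Real.sq_sqrt (by positivity)]
    congr 2
    field_simp
    ring
  have e2 : |x / √(2 * s)| * Real.exp (-(x / √(2 * s)) ^ 2 / 2) ≤ 1 := abs_mul_exp_le _
  have e3 : |x / s| = √2 * (√s)⁻¹ * |x / √(2 * s)| := by
    rw [abs_div, abs_div, abs_of_pos hs, abs_of_nonneg (Real.sqrt_nonneg _),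
      Real.sqrt_mul (by norm_num : (0 : ℝ) ≤ 2)]
    nth_rewrite 1 [← hsq]
    field_simp
  have hk := heatKernel_nonneg (2 * s) x
  rw [abs_mul, abs_neg, e3, abs_of_nonneg (heatKernel_nonneg _ _), e1]
  calc √2 * (√s)⁻¹ * |x / √(2 * s)| *
        (√2 * heatKernel (2 * s) x * Real.exp (-(x / √(2 * s)) ^ 2 / 2))
      = (√2 * √2) * (√s)⁻¹ * heatKernel (2 * s) x *
        (|x / √(2 * s)| * Real.exp (-(x / √(2 * s)) ^ 2 / 2)) := by ring
    _ ≤ (√2 * √2) * (√s)⁻¹ * heatKernel (2 * s) x * 1 := by gcongr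
    _ = _ := by rw [h2, mul_one]

lemma abs_deriv_heatKernel_le {s : ℝ} (hs : 0 < s) (x : ℝ) :
    |-(x / s) * heatKernel s x| ≤ s⁻¹ := by
  have h0 : 0 < √s := Real.sqrt_pos.2 hs
  have hsq : √s * √s = s := Real.mul_self_sqrt hs.le
  have e2 := abs_mul_exp_le (x / √s)
  have e3 : |x / s| = (√s)⁻¹ * |x / √s| := by
    rw [abs_div, abs_div, abs_of_pos hs, abs_of_pos h0]
    nth_rewrite 1 [← hsq]
    field_simp
  have e1 : heatKernel s x ≤ (√s)⁻¹ * Real.exp (-(x / √s) ^ 2 / 2) := by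
    have h1 : √s ≤ √(2 * Real.pi * s) := Real.sqrt_le_sqrt (by nlinarith [Real.pi_gt_three])
    unfold heatKernel
    rw [div_pow, Real.sq_sqrt hs.le, show -x ^ 2 / (2 * s) = -(x ^ 2 / s) / 2 by field_simp]
    gcongr
  rw [abs_mul, abs_neg, e3, abs_of_nonneg (heatKernel_nonneg _ _)]
  calc (√s)⁻¹ * |x / √s| * heatKernel s x
      ≤ (√s)⁻¹ * |x / √s| * ((√s)⁻¹ * Real.exp (-(x / √s) ^ 2 / 2)) := by gcongr
    _ = ((√s)⁻¹ * (√s)⁻¹) * (|x / √s| * Real.exp (-(x / √s) ^ 2 / 2)) := by ring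
    _ ≤ ((√s)⁻¹ * (√s)⁻¹) * 1 := by gcongr
    _ = s⁻¹ := by rw [mul_one, ← mul_inv, hsq]

lemma abs_heatKernel_sub_le {s : ℝ} (hs : 0 < s) (x y : ℝ) :
    |heatKernel s x - heatKernel s y| ≤ s⁻¹ * |x - y| := by
  have := convex_univ.norm_image_sub_le_of_norm_hasDerivWithin_le (f := heatKernel s)
    (fun x _ => (hasDerivAt_heatKernel s x).hasDerivWithinAt)
    (fun x _ => by rw [Real.norm_eq_abs]; exact abs_deriv_heatKernel_le hs x)
    (Set.mem_univ y) (Set.mem_univ x)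
  simpa [Real.norm_eq_abs] using this

/-! ### The symmetrised primitive of the heat kernel -/

/-- `∫_0^h (p_s(x + η) - p_s(x - η)) dη`. -/
noncomputable def kernelDiff (h s x : ℝ) : ℝ :=
  ∫ η in (0 : ℝ)..h, (heatKernel s (x + η) - heatKernel s (x - η))

lemma measurable_kernelDiff (h : ℝ) : Measurable (fun p : ℝ × ℝ => kernelDiff h p.1 p.2) := by
  unfold kernelDiff
  simp_rw [intervalIntegral]
  refine Measurable.sub ?_ ?_
  all_goals
    refine (StronglyMeasurable.integral_prod_right (f := fun (p : ℝ × ℝ) (η : ℝ) =>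
      heatKernel p.1 (p.2 + η) - heatKernel p.1 (p.2 - η)) ?_).measurable
    apply Measurable.stronglyMeasurable
    refine Measurable.sub ?_ ?_
    · exact measurable_heatKernel.comp
        (f := fun q : (ℝ × ℝ) × ℝ => (q.1.1, q.1.2 + q.2)) (by fun_prop)
    · exact measurable_heatKernel.comp
        (f := fun q : (ℝ × ℝ) × ℝ => (q.1.1, q.1.2 - q.2)) (by fun_prop)

lemma measurable_kernelDiff_right (h s : ℝ) : Measurable (kernelDiff h s) :=
  (measurable_kernelDiff h).comp measurable_prodMk_left

lemma continuous_kernelDiff (h : ℝ) {α : Type*} [TopologicalSpace α] {f g : α → ℝ}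
    (hf : Continuous f) (hg : Continuous g) (h0 : ∀ a, 0 < f a) :
    Continuous (fun a => kernelDiff h (f a) (g a)) := by
  unfold kernelDiff
  refine intervalIntegral.continuous_parametric_intervalIntegral_of_continuous' ?_ 0 h
  exact (continuous_heatKernel (f := fun q : α × ℝ => f q.1) (by fun_prop) (by fun_prop)
    (fun _ => h0 _)).sub (continuous_heatKernel (f := fun q : α × ℝ => f q.1)
      (by fun_prop) (by fun_prop) (fun _ => h0 _))

/-- An interval integral of symmetric increments of a Lipschitz function. -/
lemma abs_integral_symm_increment_le {Q : ℝ → ℝ} {L h : ℝ} (hh : 0 ≤ h) (hL : 0 ≤ L)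
    (hQ : ∀ x y, |Q x - Q y| ≤ L * |x - y|) (x : ℝ) :
    |∫ η in (0 : ℝ)..h, (Q (x + η) - Q (x - η))| ≤ 2 * h ^ 2 * L := by
  have := intervalIntegral.norm_integral_le_of_norm_le_const
    (a := 0) (b := h) (f := fun η => Q (x + η) - Q (x - η)) (C := 2 * h * L) ?_
  · rw [Real.norm_eq_abs, sub_zero, abs_of_nonneg hh] at this
    linarith
  · intro η hη
    rw [Set.uIoc_of_le hh] at hη
    refine (hQ _ _).trans ?_
    rw [show x + η - (x - η) = 2 * η by ring, abs_of_nonneg (by linarith [hη.1])]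
    nlinarith [hη.1, hη.2]

/-- The crude sup bound: correct order in h, but its singularity 1/s is not integrable. It provides
the boundedness needed for Fubini and for the truncated integrand, and one endpoint of the
interpolation. -/
lemma abs_kernelDiff_le {h s : ℝ} (hh : 0 ≤ h) (hs : 0 < s) (x : ℝ) :
    |kernelDiff h s x| ≤ 2 * h ^ 2 * s⁻¹ :=
  abs_integral_symm_increment_le hh (by positivity) (abs_heatKernel_sub_le hs) x

/-- Each increment is the integral of p_s' over (x-η, x+η), enlarged to (x-h, x+h). The dominating
kernel at time 2s is again a probability density, so the bound can be integrated in x. -/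
lemma abs_kernelDiff_le_integral {h s : ℝ} (hh : 0 ≤ h) (hs : 0 < s) (x : ℝ) :
    |kernelDiff h s x| ≤ h * (2 * (√s)⁻¹) * ∫ y in Set.Ioc (-h) h, heatKernel (2 * s) (x + y) := by
  have hc : Continuous fun y => 2 * (√s)⁻¹ * heatKernel (2 * s) (x + y) :=
    continuous_const.mul (continuous_heatKernel continuous_const (by fun_prop)
      (fun _ => by positivity))
  have hI : IntegrableOn (fun y => 2 * (√s)⁻¹ * heatKernel (2 * s) (x + y)) (Set.Ioc (-h) h) :=
    (hc.integrableOn_Icc).mono_set Set.Ioc_subset_Icc_self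
  have := intervalIntegral.norm_integral_le_of_norm_le_const
    (a := 0) (b := h) (f := fun η => heatKernel s (x + η) - heatKernel s (x - η))
    (C := (2 * (√s)⁻¹) * ∫ y in Set.Ioc (-h) h, heatKernel (2 * s) (x + y)) ?_
  · rw [Real.norm_eq_abs, sub_zero, abs_of_nonneg hh] at this
    unfold kernelDiff
    linarith
  · intro η hη
    rw [Set.uIoc_of_le hh] at hη
    have hd : Continuous fun y => -((x + y) / s) * heatKernel s (x + y) :=
      Continuous.mul (by fun_prop) (continuous_heatKernel continuous_const (by fun_prop)
        (fun _ => hs))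
    have hftc : ∫ y in (-η)..η, -((x + y) / s) * heatKernel s (x + y)
        = heatKernel s (x + η) - heatKernel s (x + -η) := by
      refine intervalIntegral.integral_eq_sub_of_hasDerivAt
        (f := fun y => heatKernel s (x + y)) (fun y _ => ?_) (hd.intervalIntegrable _ _)
      exact (hasDerivAt_heatKernel s (x + y)).comp_const_add x y
    rw [sub_eq_add_neg x η, ← hftc, ← integral_const_mul]
    refine (intervalIntegral.norm_integral_le_integral_norm (by linarith [hη.1])).trans ?_
    rw [intervalIntegral.integral_of_le (by linarith [hη.1])]
    calc ∫ y in Set.Ioc (-η) η, ‖-((x + y) / s) * heatKernel s (x + y)‖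
        ≤ ∫ y in Set.Ioc (-η) η, 2 * (√s)⁻¹ * heatKernel (2 * s) (x + y) := by
          refine setIntegral_mono_on ?_ ?_ measurableSet_Ioc fun y _ =>
            abs_deriv_heatKernel_le_heatKernel hs (x + y)
          · exact (hd.norm.integrableOn_Icc).mono_set Set.Ioc_subset_Icc_self
          · exact (hc.integrableOn_Icc).mono_set Set.Ioc_subset_Icc_self
      _ ≤ ∫ y in Set.Ioc (-h) h, 2 * (√s)⁻¹ * heatKernel (2 * s) (x + y) := by
          refine setIntegral_mono_set hI ?_ ?_
          · exact Eventually.of_forall fun y =>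
              mul_nonneg (by positivity) (heatKernel_nonneg _ _)
          · exact (Set.Ioc_subset_Ioc (by linarith [hη.2]) hη.2).eventuallyLE

/-- By Tonelli, the kernel at time 2s has mass one and the window has length 2h. Measuring in L¹
improves the singularity from 1/s to s^(-1/2). -/
lemma lintegral_enorm_kernelDiff_le {h s : ℝ} (hh : 0 ≤ h) (hs : 0 < s) :
    ∫⁻ x, ‖kernelDiff h s x‖ₑ ≤ ENNReal.ofReal (4 * h ^ 2 * (√s)⁻¹) := by
  have h2s : 0 < 2 * s := by positivity
  have hpt : ∀ x, ‖kernelDiff h s x‖ₑ ≤ ENNReal.ofReal (h * (2 * (√s)⁻¹)) *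
      ∫⁻ y in Set.Ioc (-h) h, ENNReal.ofReal (heatKernel (2 * s) (x + y)) := by
    intro x
    have hc : Continuous fun y => heatKernel (2 * s) (x + y) :=
      continuous_heatKernel continuous_const (by fun_prop) (fun _ => h2s)
    rw [Real.enorm_eq_ofReal_abs, ← ofReal_integral_eq_lintegral_ofReal
      ((hc.integrableOn_Icc).mono_set Set.Ioc_subset_Icc_self)
      (Eventually.of_forall fun y => heatKernel_nonneg _ _), ← ENNReal.ofReal_mul (by positivity)]
    exact ENNReal.ofReal_le_ofReal (abs_kernelDiff_le_integral hh hs x)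
  have hm : Measurable fun p : ℝ × ℝ => ENNReal.ofReal (heatKernel (2 * s) (p.1 + p.2)) :=
    (measurable_heatKernel.comp (f := fun p : ℝ × ℝ => (2 * s, p.1 + p.2)) (by fun_prop)).ennreal_ofReal
  calc ∫⁻ x, ‖kernelDiff h s x‖ₑ
      ≤ ∫⁻ x, ENNReal.ofReal (h * (2 * (√s)⁻¹)) *
        ∫⁻ y in Set.Ioc (-h) h, ENNReal.ofReal (heatKernel (2 * s) (x + y)) := lintegral_mono hpt
    _ = ENNReal.ofReal (h * (2 * (√s)⁻¹)) * ∫⁻ y in Set.Ioc (-h) h,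
        ∫⁻ x, ENNReal.ofReal (heatKernel (2 * s) (x + y)) := by
        rw [lintegral_const_mul _ hm.lintegral_prod_right', lintegral_lintegral_swap hm.aemeasurable]
    _ = ENNReal.ofReal (h * (2 * (√s)⁻¹)) * ENNReal.ofReal (2 * h) := by
        congr 1
        have : ∀ y : ℝ, ∫⁻ x, ENNReal.ofReal (heatKernel (2 * s) (x + y)) = 1 := fun y => by
          rw [lintegral_add_right_eq_self (fun x => ENNReal.ofReal (heatKernel (2 * s) x)) y,
            lintegral_heatKernel h2s]
        simp_rw [this]
        simp [two_mul]
    _ = _ := by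
        rw [← ENNReal.ofReal_mul (by positivity)]
        congr 1
        ring

/-- The expectation of `|kernelDiff h s X|` for a centred Gaussian variable `X`. -/
lemma lintegral_enorm_kernelDiff_gaussianReal_le {h s : ℝ} (hh : 0 ≤ h) (hs : 0 < s) {v : ℝ≥0}
    (hv : v ≠ 0) :
    ∫⁻ x, ‖kernelDiff h s x‖ₑ ∂(gaussianReal 0 v)
      ≤ ENNReal.ofReal ((√v)⁻¹ * (4 * h ^ 2 * (√s)⁻¹)) := by
  have hv0 : (0 : ℝ) < v := by exact_mod_cast pos_iff_ne_zero.2 hv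
  rw [gaussianReal_of_var_ne_zero _ hv, lintegral_withDensity_eq_lintegral_mul _
    (measurable_gaussianPDF _ _) (measurable_kernelDiff_right h s).enorm]
  calc ∫⁻ x, (gaussianPDF 0 v * fun x => ‖kernelDiff h s x‖ₑ) x
      ≤ ∫⁻ x, ENNReal.ofReal (√v)⁻¹ * ‖kernelDiff h s x‖ₑ := by
        refine lintegral_mono fun x => ?_
        simp only [Pi.mul_apply]
        gcongr
        rw [gaussianPDF]
        refine ENNReal.ofReal_le_ofReal ?_
        have := heatKernel_eq_gaussianPDFReal hv0 x
        rw [Real.toNNReal_coe] at this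
        rw [← this]
        exact heatKernel_le hv0 x
    _ ≤ _ := by
        rw [lintegral_const_mul _ (measurable_kernelDiff_right h s).enorm,
          ENNReal.ofReal_mul (by positivity)]
        gcongr
        exact lintegral_enorm_kernelDiff_le hh hs

/-- Smoothing by a Gaussian of variance `v` gives a function with Lipschitz constant `v⁻¹`. -/
lemma abs_integral_heatKernel_gaussianReal_sub_le {s : ℝ} (hs : 0 < s) {v : ℝ≥0} (hv : v ≠ 0)
    (z w : ℝ) :
    |∫ y, heatKernel s (z + y) ∂(gaussianReal 0 v) - ∫ y, heatKernel s (w + y) ∂(gaussianReal 0 v)|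
      ≤ (v : ℝ)⁻¹ * |z - w| := by
  have hv0 : (0 : ℝ) < v := by exact_mod_cast pos_iff_ne_zero.2 hv
  -- A translation moves z from p_s into the Gaussian density, so only the Lipschitz constant of the
  -- latter matters and p_s enters through its mass.
  have key : ∀ z : ℝ, ∫ y, heatKernel s (z + y) ∂(gaussianReal 0 v)
      = ∫ y, heatKernel v (y - z) * heatKernel s y := by
    intro z
    rw [integral_gaussianReal_eq_integral_smul hv,
      ← integral_sub_right_eq_self (fun y => gaussianPDFReal 0 v y • heatKernel s (z + y)) z]
    refine integral_congr_ae (Eventually.of_forall fun y => ?_)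
    have := heatKernel_eq_gaussianPDFReal hv0 (y - z)
    rw [Real.toNNReal_coe] at this
    simp [this]
  have hint : ∀ z : ℝ, Integrable fun y => heatKernel v (y - z) * heatKernel s y := by
    intro z
    refine (integrable_heatKernel hs).bdd_mul (c := (√v)⁻¹) ?_ ?_
    · exact (continuous_heatKernel continuous_const (by fun_prop)
        fun _ => hv0).aestronglyMeasurable
    · refine Eventually.of_forall fun y => ?_
      rw [Real.norm_eq_abs, abs_of_nonneg (heatKernel_nonneg _ _)]
      exact heatKernel_le hv0 _
  rw [key, key, ← integral_sub (hint z) (hint w)]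
  calc |∫ y, (heatKernel v (y - z) * heatKernel s y - heatKernel v (y - w) * heatKernel s y)|
      ≤ ∫ y, (v : ℝ)⁻¹ * |z - w| * heatKernel s y := by
        rw [← Real.norm_eq_abs]
        refine norm_integral_le_of_norm_le ((integrable_heatKernel hs).const_mul _)
          (Eventually.of_forall fun y => ?_)
        rw [← sub_mul, norm_mul, Real.norm_eq_abs, Real.norm_eq_abs,
          abs_of_nonneg (heatKernel_nonneg s y)]
        refine mul_le_mul_of_nonneg_right ?_ (heatKernel_nonneg _ _)
        refine (abs_heatKernel_sub_le hv0 _ _).trans_eq ?_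
        rw [show y - z - (y - w) = -(z - w) by ring, abs_neg]
    _ = _ := by rw [integral_const_mul, integral_heatKernel hs, mul_one]

/-- Averaging commutes with the η-integral, so the symmetric-increment bound applies to the smoothed
kernel, with v⁻¹ in place of s⁻¹. -/
lemma abs_integral_kernelDiff_gaussianReal_le {h s : ℝ} (hh : 0 ≤ h) (hs : 0 < s) {v : ℝ≥0}
    (hv : v ≠ 0) (x : ℝ) :
    |∫ y, kernelDiff h s (x + y) ∂(gaussianReal 0 v)| ≤ 2 * h ^ 2 * (v : ℝ)⁻¹ := by
  have hbd : ∀ z, ‖heatKernel s z‖ ≤ (√s)⁻¹ := fun z => by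
    rw [Real.norm_eq_abs, abs_of_nonneg (heatKernel_nonneg _ _)]
    exact heatKernel_le hs _
  have hc : Continuous (heatKernel s) :=
    continuous_heatKernel continuous_const continuous_id fun _ => hs
  have hint : ∀ z : ℝ, Integrable (fun y => heatKernel s (z + y)) (gaussianReal 0 v) := fun z =>
    Integrable.of_bound (hc.comp (by fun_prop)).aestronglyMeasurable _
      (Eventually.of_forall fun y => hbd _)
  have hswap : ∫ y, kernelDiff h s (x + y) ∂(gaussianReal 0 v)
      = ∫ η in (0 : ℝ)..h, ((∫ y, heatKernel s (x + η + y) ∂(gaussianReal 0 v))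
        - ∫ y, heatKernel s (x - η + y) ∂(gaussianReal 0 v)) := by
    unfold kernelDiff
    simp_rw [intervalIntegral.integral_of_le hh]
    rw [integral_integral_swap]
    · refine integral_congr_ae (Eventually.of_forall fun η => ?_)
      simp only
      rw [← integral_sub (hint _) (hint _)]
      refine integral_congr_ae (Eventually.of_forall fun y => ?_)
      simp only
      congr 2 <;> ring
    · refine Integrable.of_bound (C := 2 * (√s)⁻¹) ?_ (Eventually.of_forall fun p => ?_)
      · refine Continuous.aestronglyMeasurable ?_
        exact (hc.comp (f := fun p : ℝ × ℝ => x + p.1 + p.2) (by fun_prop)).sub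
          (hc.comp (f := fun p : ℝ × ℝ => x + p.1 - p.2) (by fun_prop))
      · refine (norm_sub_le _ _).trans ?_
        linarith [hbd (x + p.1 + p.2), hbd (x + p.1 - p.2)]
  rw [hswap]
  exact abs_integral_symm_increment_le
    (Q := fun z => ∫ y, heatKernel s (z + y) ∂(gaussianReal 0 v)) hh (by positivity)
    (abs_integral_heatKernel_gaussianReal_sub_le hs hv) x

lemma le_rpow_mul_rpow {m a b : ℝ} (hm : 0 ≤ m) (ha : m ≤ a) (hb : m ≤ b) {p q : ℝ} (hp : 0 ≤ p)
    (hq : 0 ≤ q) (hpq : p + q = 1) : m ≤ a ^ p * b ^ q := by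
  calc m = m ^ p * m ^ q := by rw [← Real.rpow_add_of_nonneg hm hp hq, hpq, Real.rpow_one]
    _ ≤ _ := by
        have := Real.rpow_nonneg (hm.trans ha) p
        gcongr

/-- Geometric interpolation between the bounds s⁻¹ and v⁻¹. With weight θ on s⁻¹, the exponents to
be integrated later are 1/2 + θ in s and 1 - θ in v; both are below 1 exactly for 0 < θ < 1/2, and θ
= 1/4 is chosen. -/
lemma abs_integral_kernelDiff_gaussianReal_le_rpow {h s : ℝ} (hh : 0 ≤ h) (hs : 0 < s) {v : ℝ≥0}
    (hv : v ≠ 0) (x : ℝ) :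
    |∫ y, kernelDiff h s (x + y) ∂(gaussianReal 0 v)|
      ≤ 2 * h ^ 2 * (s ^ (-(1 / 4) : ℝ) * (v : ℝ) ^ (-(3 / 4) : ℝ)) := by
  have hv0 : (0 : ℝ) < v := by exact_mod_cast pos_iff_ne_zero.2 hv
  have h1 := abs_integral_kernelDiff_gaussianReal_le hh hs hv x
  have h2 : |∫ y, kernelDiff h s (x + y) ∂(gaussianReal 0 v)| ≤ 2 * h ^ 2 * s⁻¹ := by
    have := norm_integral_le_of_norm_le_const (μ := gaussianReal 0 v)
      (f := fun y => kernelDiff h s (x + y)) (C := 2 * h ^ 2 * s⁻¹)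
      (Eventually.of_forall fun y => abs_kernelDiff_le hh hs _)
    simpa using this
  have h3 : min s⁻¹ (v : ℝ)⁻¹ ≤ s⁻¹ ^ (1 / 4 : ℝ) * (v : ℝ)⁻¹ ^ (3 / 4 : ℝ) :=
    le_rpow_mul_rpow (by positivity) (min_le_left _ _) (min_le_right _ _) (by norm_num)
      (by norm_num) (by norm_num)
  rw [Real.rpow_neg hs.le, Real.rpow_neg hv0.le, ← Real.inv_rpow hs.le, ← Real.inv_rpow hv0.le]
  refine le_trans ?_ (mul_le_mul_of_nonneg_left h3 (by positivity))
  rcases min_choice s⁻¹ (v : ℝ)⁻¹ with h | h <;> rw [h] <;> assumption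

/-! ### Integrable power singularities -/

/-- The weight `|x|^(-α)` with values in `ℝ≥0∞`. -/
noncomputable def powWeight (α x : ℝ) : ℝ≥0∞ := ENNReal.ofReal (|x| ^ (-α))

lemma measurable_powWeight (α : ℝ) : Measurable (powWeight α) := by
  unfold powWeight; fun_prop

lemma powWeight_neg (α x : ℝ) : powWeight α (-x) = powWeight α x := by
  simp [powWeight]

lemma powWeight_sub_comm (α x y : ℝ) : powWeight α (x - y) = powWeight α (y - x) := by
  rw [← powWeight_neg, neg_sub]

lemma lintegral_powWeight_lt_top {α : ℝ} (hα : α < 1) {t : ℝ} (ht : 0 ≤ t) :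
    ∫⁻ x in Set.Icc (-t) t, powWeight α x < ∞ := by
  have h1 : IntervalIntegrable (fun x : ℝ => |x| ^ (-α)) volume 0 t := by
    refine (intervalIntegral.intervalIntegrable_rpow' (a := 0) (b := t)
      (by linarith : -1 < -α)).congr ?_
    intro x hx
    rw [Set.uIoc_of_le ht] at hx
    simp [abs_of_pos hx.1]
  have h2 : IntervalIntegrable (fun x : ℝ => |x| ^ (-α)) volume (-t) 0 := by
    have := (IntervalIntegrable.iff_comp_neg).1 h1
    simpa using this.symm
  have h3 := (intervalIntegrable_iff_integrableOn_Icc_of_le (by linarith)).1 (h2.trans h1)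
  exact h3.lintegral_lt_top

/-- The reflected translate of [0, t] lies in [-t, t], so the bound is uniform in the position a of
the singularity. -/
lemma lintegral_powWeight_sub_le {α a t : ℝ} (h0 : 0 ≤ a) (h1 : a ≤ t) :
    ∫⁻ x in Set.Icc 0 t, powWeight α (a - x) ≤ ∫⁻ x in Set.Icc (-t) t, powWeight α x := by
  rw [← lintegral_indicator measurableSet_Icc, ← lintegral_indicator measurableSet_Icc,
    
    ← lintegral_sub_left_eq_self ((Set.Icc (-t) t).indicator (powWeight α)) a]
  refine lintegral_mono fun x => ?_
  by_cases hx : x ∈ Set.Icc 0 t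
  · have hx' : a - x ∈ Set.Icc (-t) t := ⟨by linarith [hx.2], by linarith [hx.1]⟩
    simp [Set.indicator_of_mem hx, Set.indicator_of_mem hx']
  · simp [Set.indicator_of_notMem hx]

/-- The covariance bound is singular at r in the larger of u and v only. Adding both weights removes
the case distinction, and the two resulting terms agree after exchanging u and v. -/
lemma lintegral_lintegral_powWeight_le {r t : ℝ} (hr : 0 ≤ r) (hrt : r ≤ t) (α β : ℝ) :
    ∫⁻ u in Set.Ioc 0 r, ∫⁻ v in Set.Ioc 0 r,
        (powWeight α (r - u) + powWeight α (r - v)) * powWeight β (u - v)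
      ≤ 2 * ((∫⁻ x in Set.Icc (-t) t, powWeight α x) * ∫⁻ x in Set.Icc (-t) t, powWeight β x) := by
  set μ : Measure ℝ := volume.restrict (Set.Ioc 0 r) with hμ
  have hsub : Set.Ioc 0 r ⊆ Set.Icc 0 t := fun x hx => ⟨hx.1.le, hx.2.trans hrt⟩
  have hα := measurable_powWeight α
  have hβ := measurable_powWeight β
  have hA : ∫⁻ u, powWeight α (r - u) ∂μ ≤ ∫⁻ x in Set.Icc (-t) t, powWeight α x :=
    (lintegral_mono_set hsub).trans (lintegral_powWeight_sub_le hr hrt)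
  have hB : ∀ u ∈ Set.Ioc 0 r, ∫⁻ v, powWeight β (u - v) ∂μ
      ≤ ∫⁻ x in Set.Icc (-t) t, powWeight β x := fun u hu =>
    (lintegral_mono_set hsub).trans (lintegral_powWeight_sub_le hu.1.le (hu.2.trans hrt))
  have key : ∫⁻ u, ∫⁻ v, powWeight α (r - u) * powWeight β (u - v) ∂μ ∂μ
      ≤ (∫⁻ x in Set.Icc (-t) t, powWeight α x) * ∫⁻ x in Set.Icc (-t) t, powWeight β x := by
    calc ∫⁻ u, ∫⁻ v, powWeight α (r - u) * powWeight β (u - v) ∂μ ∂μ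
        ≤ ∫⁻ u, powWeight α (r - u) * (∫⁻ x in Set.Icc (-t) t, powWeight β x) ∂μ := by
          refine setLIntegral_mono' measurableSet_Ioc fun u hu => ?_
          rw [lintegral_const_mul _ (by fun_prop)]
          exact mul_le_mul' le_rfl (hB u hu)
      _ = (∫⁻ u, powWeight α (r - u) ∂μ) * (∫⁻ x in Set.Icc (-t) t, powWeight β x) :=
          lintegral_mul_const _ (by fun_prop)
      _ ≤ _ := by gcongr
  have hswap : ∫⁻ u, ∫⁻ v, powWeight α (r - v) * powWeight β (u - v) ∂μ ∂μ
      = ∫⁻ u, ∫⁻ v, powWeight α (r - u) * powWeight β (u - v) ∂μ ∂μ := by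
    rw [lintegral_lintegral_swap (by fun_prop)]
    simp_rw [powWeight_sub_comm β]
  simp_rw [add_mul]
  calc _ = ∫⁻ u, ∫⁻ v, powWeight α (r - u) * powWeight β (u - v) ∂μ ∂μ
        + ∫⁻ u, ∫⁻ v, powWeight α (r - v) * powWeight β (u - v) ∂μ ∂μ := by
        rw [← lintegral_add_left (by fun_prop)]
        refine lintegral_congr fun u => ?_
        rw [lintegral_add_left (by fun_prop)]
    _ ≤ _ := by
        rw [hswap, two_mul]
        gcongr

/-! ### Second moments of integrals over a parameter -/

/-- The square of an integral is a double integral, and Fubini exchanges it with the expectation.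
The norm stays outside the expectation, so that cancellation between the two factors is not lost. -/
lemma lintegral_enorm_integral_sq_le {α Ω : Type*} [MeasurableSpace α] [MeasurableSpace Ω]
    (μ : Measure α) [IsFiniteMeasure μ] (P : Measure Ω) [IsFiniteMeasure P] {f : α → Ω → ℝ}
    (hf : Measurable (Function.uncurry f)) {M : ℝ} (hM : ∀ u ω, |f u ω| ≤ M) :
    ∫⁻ ω, ‖∫ u, f u ω ∂μ‖ₑ ^ 2 ∂P
      ≤ ∫⁻ u, ∫⁻ v, ‖∫ ω, f u ω * f v ω ∂P‖ₑ ∂μ ∂μ := by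
  have hm : Measurable fun q : (α × α) × Ω => f q.1.1 q.2 * f q.1.2 q.2 :=
    (hf.comp (g := Function.uncurry f) (f := fun q : (α × α) × Ω => (q.1.1, q.2))
      (by fun_prop)).mul
      (hf.comp (g := Function.uncurry f) (f := fun q : (α × α) × Ω => (q.1.2, q.2)) (by fun_prop))
  have hb : ∀ q : (α × α) × Ω, ‖f q.1.1 q.2 * f q.1.2 q.2‖ ≤ M * M := fun q => by
    rw [norm_mul]
    exact mul_le_mul (hM _ _) (hM _ _) (norm_nonneg _) ((abs_nonneg _).trans (hM q.1.1 q.2))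
  have hint : Integrable (fun q : (α × α) × Ω => f q.1.1 q.2 * f q.1.2 q.2)
      ((μ.prod μ).prod P) :=
    Integrable.of_bound hm.aestronglyMeasurable _ (Eventually.of_forall hb)
  have h1 : ∀ ω, (∫ u, f u ω ∂μ) ^ 2 = ∫ q : α × α, f q.1 ω * f q.2 ω ∂(μ.prod μ) := fun ω => by
    rw [sq, integral_prod_mul (fun u => f u ω) (fun u => f u ω)]
  have h2 : ∫⁻ ω, ‖∫ u, f u ω ∂μ‖ₑ ^ 2 ∂P
      = ENNReal.ofReal (∫ ω, (∫ u, f u ω ∂μ) ^ 2 ∂P) := by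
    rw [ofReal_integral_eq_lintegral_ofReal]
    · refine lintegral_congr fun ω => ?_
      rw [← sq_abs, ENNReal.ofReal_pow (abs_nonneg _), Real.enorm_eq_ofReal_abs]
    · simp_rw [h1]
      exact hint.integral_prod_right
    · exact Eventually.of_forall fun ω => sq_nonneg _
  rw [h2]
  simp_rw [h1]
  rw [integral_integral_swap (f := fun ω (q : α × α) => f q.1 ω * f q.2 ω) hint.swap]
  calc ENNReal.ofReal (∫ q : α × α, ∫ ω, f q.1 ω * f q.2 ω ∂P ∂(μ.prod μ))
      ≤ ‖∫ q : α × α, ∫ ω, f q.1 ω * f q.2 ω ∂P ∂(μ.prod μ)‖ₑ := by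
        rw [Real.enorm_eq_ofReal_abs]
        exact ENNReal.ofReal_le_ofReal (le_abs_self _)
    _ ≤ ∫⁻ q : α × α, ‖∫ ω, f q.1 ω * f q.2 ω ∂P‖ₑ ∂(μ.prod μ) :=
        enorm_integral_le_lintegral_enorm _
    _ = _ := lintegral_prod _ hint.integral_prod_left.aestronglyMeasurable.enorm

/-! ### Moment bounds along Brownian paths -/

variable {Ω : Type*} {mΩ : MeasurableSpace Ω} {P : Measure Ω} {B : ℝ≥0 → Ω → ℝ}

/-- The second increment is a function of the path up to v, the first of the path shifted by v. -/
lemma indepFun_increments (hB : IsPreBrownianReal B P) {u v r : ℝ≥0} (huv : u ≤ v) (hvr : v ≤ r) :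
    IndepFun (fun ω => B r ω - B v ω) (fun ω => B v ω - B u ω) P := by
  have hφ : Measurable fun x : ℝ≥0 → ℝ => x (r - v) := measurable_pi_apply _
  have h := (hB.indepFun_shift v).comp (φ := fun x : ℝ≥0 → ℝ => x (r - v))
    (ψ := fun x : Set.Iic v → ℝ => x ⟨v, le_refl v⟩ - x ⟨u, huv⟩) hφ
    (by fun_prop)
  have e : v + (r - v) = r := add_tsub_cancel_of_le hvr
  simpa [Function.comp_def, e] using h

lemma map_sub_eq_gaussianReal (hB : IsPreBrownianReal B P) {v r : ℝ≥0} (hvr : v ≤ r) :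
    P.map (fun ω => B r ω - B v ω) = gaussianReal 0 (r - v) := by
  have h := (hB.hasLaw_sub r v).map_eq
  have e : nndist (r : ℝ) (v : ℝ) = r - v := by
    apply NNReal.eq
    rw [coe_nndist, Real.dist_eq, NNReal.coe_sub hvr,
      abs_of_nonneg (sub_nonneg.2 (NNReal.coe_le_coe.2 hvr))]
  rw [← e]
  exact h

/-- With B_r - B_u = X + Y, the expectation becomes an iterated integral over the product law: the
inner one, over Y, is bounded uniformly in x by interpolation, the outer one, over X, by the L¹
estimate. -/
lemma enorm_integral_kernelDiff_mul_le_of_lt (hB : IsPreBrownianReal B P) {h s : ℝ} (hh : 0 ≤ h)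
    (hs : 0 < s) {u v r : ℝ≥0} (huv : u < v) (hvr : v < r) :
    ‖∫ ω, kernelDiff h s (B r ω - B u ω) * kernelDiff h s (B r ω - B v ω) ∂P‖ₑ
      ≤ ENNReal.ofReal (8 * h ^ 4) * powWeight (3 / 4) s *
        (powWeight (1 / 2) (r - v) * powWeight (3 / 4) (u - v)) := by
  have : IsProbabilityMeasure P := hB.isGaussianProcess.isProbabilityMeasure
  have hm1 : AEMeasurable (fun ω => B r ω - B v ω) P := (hB.aemeasurable r).sub (hB.aemeasurable v)
  have hm2 : AEMeasurable (fun ω => B v ω - B u ω) P := (hB.aemeasurable v).sub (hB.aemeasurable u)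
  have hk := measurable_kernelDiff_right h s
  have hv1 : r - v ≠ 0 := (tsub_pos_of_lt hvr).ne'
  have hv2 : v - u ≠ 0 := (tsub_pos_of_lt huv).ne'
  have hlaw : P.map (fun ω => (B r ω - B v ω, B v ω - B u ω))
      = (gaussianReal 0 (r - v)).prod (gaussianReal 0 (v - u)) := by
    rw [(indepFun_iff_map_prod_eq_prod_map_map hm1 hm2).1
      (indepFun_increments hB huv.le hvr.le), map_sub_eq_gaussianReal hB hvr.le,
      map_sub_eq_gaussianReal hB huv.le]
  have hmeas : Measurable fun q : ℝ × ℝ => kernelDiff h s (q.1 + q.2) * kernelDiff h s q.1 :=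
    (hk.comp (by fun_prop)).mul (hk.comp (by fun_prop))
  have e1 : ∫ ω, kernelDiff h s (B r ω - B u ω) * kernelDiff h s (B r ω - B v ω) ∂P
      = ∫ x, kernelDiff h s x * ∫ y, kernelDiff h s (x + y) ∂(gaussianReal 0 (v - u))
        ∂(gaussianReal 0 (r - v)) := by
    calc _ = ∫ q, kernelDiff h s (q.1 + q.2) * kernelDiff h s q.1
          ∂(P.map (fun ω => (B r ω - B v ω, B v ω - B u ω))) := by
          rw [integral_map (hm1.prodMk hm2) hmeas.aestronglyMeasurable]
          simp
      _ = _ := by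
          rw [hlaw, integral_prod]
          · simp_rw [integral_mul_const, mul_comm]
          · refine Integrable.of_bound hmeas.aestronglyMeasurable
              (2 * h ^ 2 * s⁻¹ * (2 * h ^ 2 * s⁻¹)) (Eventually.of_forall fun q => ?_)
            rw [norm_mul]
            exact mul_le_mul (abs_kernelDiff_le hh hs _) (abs_kernelDiff_le hh hs _)
              (norm_nonneg _) (by positivity)
  have hvu0 : (0 : ℝ) < v - u := sub_pos.2 (by exact_mod_cast huv)
  have hrv0 : (0 : ℝ) < r - v := sub_pos.2 (by exact_mod_cast hvr)
  have ev : ((v - u : ℝ≥0) : ℝ) = v - u := NNReal.coe_sub huv.le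
  have er : ((r - v : ℝ≥0) : ℝ) = r - v := NNReal.coe_sub hvr.le
  rw [e1]
  refine (enorm_integral_le_lintegral_enorm _).trans ?_
  set D : ℝ := 2 * h ^ 2 * (s ^ (-(1 / 4) : ℝ) * ((v : ℝ) - u) ^ (-(3 / 4) : ℝ)) with hD
  have hD0 : 0 ≤ D := by positivity
  calc ∫⁻ x, ‖kernelDiff h s x * ∫ y, kernelDiff h s (x + y) ∂(gaussianReal 0 (v - u))‖ₑ
        ∂(gaussianReal 0 (r - v))
      ≤ ∫⁻ x, ‖kernelDiff h s x‖ₑ * ENNReal.ofReal D ∂(gaussianReal 0 (r - v)) := by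
        refine lintegral_mono fun x => ?_
        rw [enorm_mul]
        gcongr
        rw [Real.enorm_eq_ofReal_abs]
        refine ENNReal.ofReal_le_ofReal ?_
        have := abs_integral_kernelDiff_gaussianReal_le_rpow hh hs hv2 x
        rwa [ev] at this
    _ ≤ ENNReal.ofReal ((√((r : ℝ) - v))⁻¹ * (4 * h ^ 2 * (√s)⁻¹)) * ENNReal.ofReal D := by
        rw [lintegral_mul_const _ hk.enorm, ← er]
        gcongr
        exact lintegral_enorm_kernelDiff_gaussianReal_le hh hs hv1
    _ = _ := by
        unfold powWeight
        rw [abs_of_pos hs, abs_of_pos hrv0, abs_sub_comm, abs_of_pos hvu0,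
          ← ENNReal.ofReal_mul (by positivity), ← ENNReal.ofReal_mul (by positivity),
          ← ENNReal.ofReal_mul (by positivity), ← ENNReal.ofReal_mul (by positivity)]
        congr 1
        rw [hD, Real.sqrt_eq_rpow, Real.sqrt_eq_rpow, ← Real.rpow_neg hrv0.le,
          ← Real.rpow_neg hs.le, show (-(3 / 4) : ℝ) = -(1 / 2) + -(1 / 4) by norm_num,
          Real.rpow_add hs]
        ring

lemma enorm_integral_kernelDiff_mul_le (hB : IsPreBrownianReal B P) {h s : ℝ} (hh : 0 ≤ h)
    (hs : 0 < s) {u v r : ℝ} (hu : 0 < u) (hv : 0 < v) (huv : u ≠ v) (hur : u < r) (hvr : v < r) :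
    ‖∫ ω, kernelDiff h s (B r.toNNReal ω - B u.toNNReal ω)
        * kernelDiff h s (B r.toNNReal ω - B v.toNNReal ω) ∂P‖ₑ
      ≤ ENNReal.ofReal (8 * h ^ 4) * powWeight (3 / 4) s *
        ((powWeight (1 / 2) (r - u) + powWeight (1 / 2) (r - v)) * powWeight (3 / 4) (u - v)) := by
  have hr : 0 < r := hu.trans hur
  rcases lt_or_gt_of_ne huv with h1 | h1
  · have := enorm_integral_kernelDiff_mul_le_of_lt hB hh hs
      ((Real.toNNReal_lt_toNNReal_iff hv).2 h1) ((Real.toNNReal_lt_toNNReal_iff hr).2 hvr)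
    rw [Real.coe_toNNReal _ hu.le, Real.coe_toNNReal _ hv.le, Real.coe_toNNReal _ hr.le] at this
    refine this.trans ?_
    gcongr
    exact le_add_self
  · have := enorm_integral_kernelDiff_mul_le_of_lt hB hh hs
      ((Real.toNNReal_lt_toNNReal_iff hu).2 h1) ((Real.toNNReal_lt_toNNReal_iff hr).2 hur)
    rw [Real.coe_toNNReal _ hu.le, Real.coe_toNNReal _ hv.le, Real.coe_toNNReal _ hr.le] at this
    simp_rw [mul_comm (kernelDiff h s (B r.toNNReal _ - B u.toNNReal _))]
    rw [powWeight_sub_comm (3 / 4) u v]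
    refine this.trans ?_
    gcongr
    exact le_self_add

lemma measurable_uncurry_of_continuous (hBm : ∀ s, Measurable (B s))
    (hBc : ∀ ω, Continuous fun s => B s ω) : Measurable (Function.uncurry B) :=
  measurable_uncurry_of_continuous_of_measurable hBc hBm

lemma uHat_eq (B : ℝ≥0 → Ω → ℝ) (t : ℝ≥0) (h r : ℝ) (ω : Ω) :
    uHat B t h r ω = 4 * ∫ u in (0 : ℝ)..r,
      kernelDiff h (t - r) (B r.toNNReal ω - B u.toNNReal ω) := rfl

lemma measurable_uHat (hB : Measurable (Function.uncurry B)) (t : ℝ≥0) (h : ℝ) :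
    Measurable fun p : Ω × ℝ => uHat B t h p.2 p.1 := by
  have hk : Measurable fun q : (Ω × ℝ) × ℝ => kernelDiff h (t - q.1.2)
      (B q.1.2.toNNReal q.1.1 - B q.2.toNNReal q.1.1) := by
    refine (measurable_kernelDiff h).comp (f := fun q : (Ω × ℝ) × ℝ => ((t : ℝ) - q.1.2,
      B q.1.2.toNNReal q.1.1 - B q.2.toNNReal q.1.1)) (Measurable.prodMk (by fun_prop) ?_)
    exact (hB.comp (f := fun q : (Ω × ℝ) × ℝ => (q.1.2.toNNReal, q.1.1)) (by fun_prop)).sub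
      (hB.comp (f := fun q : (Ω × ℝ) × ℝ => (q.2.toNNReal, q.1.1)) (by fun_prop))
  -- The endpoint r varies with the parameter, so it is moved into an indicator before measurability
  -- of parametrised integrals is used.
  simp_rw [uHat_eq, intervalIntegral, ← integral_indicator measurableSet_Ioc]
  refine (Measurable.sub ?_ ?_).const_mul 4
  · refine (StronglyMeasurable.integral_prod_right' (f := fun q : (Ω × ℝ) × ℝ =>
      (Set.Ioc 0 q.1.2).indicator (fun u => kernelDiff h (t - q.1.2)
      (B q.1.2.toNNReal q.1.1 - B u.toNNReal q.1.1)) q.2) ?_).measurable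
    refine (Measurable.ite (p := fun q : (Ω × ℝ) × ℝ => 0 < q.2 ∧ q.2 ≤ q.1.2) ?_ hk
      measurable_const).stronglyMeasurable
    exact (measurableSet_lt measurable_const measurable_snd).inter
      (measurableSet_le measurable_snd measurable_fst.snd)
  · refine (StronglyMeasurable.integral_prod_right' (f := fun q : (Ω × ℝ) × ℝ =>
      (Set.Ioc q.1.2 0).indicator (fun u => kernelDiff h (t - q.1.2)
      (B q.1.2.toNNReal q.1.1 - B u.toNNReal q.1.1)) q.2) ?_).measurable
    refine (Measurable.ite (p := fun q : (Ω × ℝ) × ℝ => q.1.2 < q.2 ∧ q.2 ≤ 0) ?_ hk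
      measurable_const).stronglyMeasurable
    exact (measurableSet_lt measurable_fst.snd measurable_snd).inter
      (measurableSet_le measurable_snd measurable_const)

lemma lintegral_enorm_uHat_sq_le (hB : IsPreBrownianReal B P)
    (hBm : Measurable (Function.uncurry B)) (t : ℝ≥0) {h : ℝ} (hh : 0 ≤ h) {r : ℝ} (hr : 0 ≤ r)
    (hrt : r < t) :
    ∫⁻ ω, ‖uHat B t h r ω‖ₑ ^ 2 ∂P ≤ 16 * (ENNReal.ofReal (8 * h ^ 4) * powWeight (3 / 4) (t - r) *
      (2 * ((∫⁻ x in Set.Icc (-t : ℝ) t, powWeight (1 / 2) x) *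
        ∫⁻ x in Set.Icc (-t : ℝ) t, powWeight (3 / 4) x))) := by
  have : IsProbabilityMeasure P := hB.isGaussianProcess.isProbabilityMeasure
  have hs : 0 < (t : ℝ) - r := sub_pos.2 hrt
  set f : ℝ → Ω → ℝ := fun u ω => kernelDiff h (t - r) (B r.toNNReal ω - B u.toNNReal ω) with hf
  have hfm : Measurable (Function.uncurry f) := by
    refine (measurable_kernelDiff_right h _).comp (f := fun q : ℝ × Ω =>
      B r.toNNReal q.2 - B q.1.toNNReal q.2) ?_
    exact (hBm.comp (f := fun q : ℝ × Ω => (r.toNNReal, q.2)) (by fun_prop)).sub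
      (hBm.comp (f := fun q : ℝ × Ω => (q.1.toNNReal, q.2)) (by fun_prop))
  have h1 : ∀ ω, ‖uHat B t h r ω‖ₑ ^ 2 = 16 * ‖∫ u in Set.Ioc 0 r, f u ω‖ₑ ^ 2 := fun ω => by
    rw [uHat_eq, enorm_mul, mul_pow, intervalIntegral.integral_of_le hr, Real.enorm_eq_ofReal_abs]
    norm_num [hf]
  have hmeas2 : Measurable fun ω => ‖∫ u in Set.Ioc 0 r, f u ω‖ₑ ^ 2 :=
    (StronglyMeasurable.integral_prod_left' hfm.stronglyMeasurable).measurable.enorm.pow_const 2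
  simp_rw [h1]
  rw [lintegral_const_mul _ hmeas2]
  gcongr
  refine (lintegral_enorm_integral_sq_le _ P hfm fun u ω => abs_kernelDiff_le hh hs _).trans ?_
  set c := ENNReal.ofReal (8 * h ^ 4) * powWeight (3 / 4) (t - r) with hc
  have hmw : Measurable fun q : ℝ × ℝ =>
      (powWeight (1 / 2) (r - q.1) + powWeight (1 / 2) (r - q.2)) * powWeight (3 / 4) (q.1 - q.2) := by
    have h2 := measurable_powWeight (1 / 2)
    have h4 := measurable_powWeight (3 / 4)
    fun_prop
  have hmw' : ∀ u : ℝ, Measurable fun v : ℝ =>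
      (powWeight (1 / 2) (r - u) + powWeight (1 / 2) (r - v)) * powWeight (3 / 4) (u - v) := by
    have h2 := measurable_powWeight (1 / 2)
    have h4 := measurable_powWeight (3 / 4)
    intro u
    fun_prop
  calc ∫⁻ u in Set.Ioc 0 r, ∫⁻ v in Set.Ioc 0 r, ‖∫ ω, f u ω * f v ω ∂P‖ₑ
      ≤ ∫⁻ u in Set.Ioc 0 r, ∫⁻ v in Set.Ioc 0 r,
        c * ((powWeight (1 / 2) (r - u) + powWeight (1 / 2) (r - v)) * powWeight (3 / 4) (u - v)) := by
        -- The covariance bound needs u ≠ v and u, v < r; the diagonal and the endpoint are null.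
        have hne : ∀ a : ℝ, ∀ᵐ v ∂(volume.restrict (Set.Ioc 0 r)), v ≠ a := fun a =>
          ae_restrict_of_ae (by simp [ae_iff])
        refine lintegral_mono_ae ?_
        filter_upwards [ae_restrict_mem measurableSet_Ioc, hne r] with u hu hur
        refine lintegral_mono_ae ?_
        filter_upwards [ae_restrict_mem measurableSet_Ioc, hne r, hne u] with v hv hvr hvu
        exact enorm_integral_kernelDiff_mul_le hB hh hs hu.1 hv.1 hvu.symm (lt_of_le_of_ne hu.2 hur)
          (lt_of_le_of_ne hv.2 hvr)
    _ = c * ∫⁻ u in Set.Ioc 0 r, ∫⁻ v in Set.Ioc 0 r,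
        (powWeight (1 / 2) (r - u) + powWeight (1 / 2) (r - v)) * powWeight (3 / 4) (u - v) := by
        rw [← lintegral_const_mul _ hmw.lintegral_prod_right']
        refine lintegral_congr fun u => ?_
        exact lintegral_const_mul c (hmw' u)
    _ ≤ _ := by
        gcongr
        exact lintegral_lintegral_powWeight_le hr hrt.le _ _

lemma exists_lintegral_enorm_uHat_sq_le_of_continuous [IsProbabilityMeasure P]
    (hB : IsPreBrownianReal B P) (hBm : Measurable (Function.uncurry B)) (t : ℝ≥0) :
    ∃ C : ℝ, 0 < C ∧ ∀ h : ℝ, 0 < h →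
      ∫⁻ p : Ω × ℝ, ‖uHat B t h p.2 p.1‖ₑ ^ 2 ∂(P.prod (volume.restrict (Set.Icc 0 (t : ℝ))))
        ≤ ENNReal.ofReal (C * h ^ 4) := by
  set W1 := ∫⁻ x in Set.Icc (-t : ℝ) t, powWeight (1 / 2) x with hW1
  set W3 := ∫⁻ x in Set.Icc (-t : ℝ) t, powWeight (3 / 4) x with hW3
  have h1 : W1 ≠ ∞ := (lintegral_powWeight_lt_top (by norm_num) t.2).ne
  have h3 : W3 ≠ ∞ := (lintegral_powWeight_lt_top (by norm_num) t.2).ne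
  set K : ℝ≥0∞ := 16 * (8 * W3 * (2 * (W1 * W3))) with hK
  have hKt : K ≠ ∞ := by
    rw [hK]
    exact ENNReal.mul_ne_top (by norm_num) (ENNReal.mul_ne_top (ENNReal.mul_ne_top (by norm_num) h3)
      (ENNReal.mul_ne_top (by norm_num) (ENNReal.mul_ne_top h1 h3)))
  -- The added 1 only makes the constant strictly positive.
  refine ⟨K.toReal + 1, by positivity, fun h hh => ?_⟩
  have hm := measurable_uHat hBm t h
  rw [lintegral_prod_symm' _ (hm.enorm.pow_const 2)]
  calc ∫⁻ r in Set.Icc 0 (t : ℝ), ∫⁻ ω, ‖uHat B t h r ω‖ₑ ^ 2 ∂P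
      ≤ ∫⁻ r in Set.Icc 0 (t : ℝ), powWeight (3 / 4) (t - r) *
        (16 * (ENNReal.ofReal (8 * h ^ 4) * (2 * (W1 * W3)))) := by
        refine lintegral_mono_ae ?_
        have hne : ∀ᵐ v ∂(volume.restrict (Set.Icc 0 (t : ℝ))), v ≠ (t : ℝ) :=
          ae_restrict_of_ae (by simp [ae_iff])
        filter_upwards [ae_restrict_mem measurableSet_Icc, hne] with r hr hrt
        refine (lintegral_enorm_uHat_sq_le hB hBm t hh.le hr.1
          (lt_of_le_of_ne hr.2 hrt)).trans_eq ?_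
        ring
    _ ≤ W3 * (16 * (ENNReal.ofReal (8 * h ^ 4) * (2 * (W1 * W3)))) := by
        have := measurable_powWeight (3 / 4)
        rw [lintegral_mul_const _ (by fun_prop)]
        gcongr
        exact lintegral_powWeight_sub_le t.2 le_rfl
    _ = K * ENNReal.ofReal (h ^ 4) := by
        rw [ENNReal.ofReal_mul (by norm_num), hK, ENNReal.ofReal_ofNat]
        ring
    _ ≤ ENNReal.ofReal (K.toReal + 1) * ENNReal.ofReal (h ^ 4) := by
        gcongr
        rw [← ENNReal.ofReal_toReal hKt]
        exact ENNReal.ofReal_le_ofReal (by simp)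
    _ = _ := (ENNReal.ofReal_mul (by positivity)).symm

/-- A Brownian motion agrees almost surely with one all of whose paths are continuous. -/
lemma exists_continuous_modification (hBm : ∀ s, Measurable (B s)) (hB : IsBrownianReal B P) :
    ∃ B' : ℝ≥0 → Ω → ℝ, (∀ s, Measurable (B' s)) ∧ (∀ ω, Continuous fun s => B' s ω) ∧
      IsPreBrownianReal B' P ∧ ∀ᵐ ω ∂P, ∀ s, B' s ω = B s ω := by
  classical
  -- Paths are replaced by zero on a measurable null set. This may destroy adaptedness to the
  -- generated filtration of B, so the modification serves only for measurability and moments of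
  -- `uHat`, never for the stochastic integral.
  obtain ⟨N, hN, hNm, hN0⟩ := exists_measurable_superset_of_null hB.cont
  have hae : ∀ᵐ ω ∂P, ω ∉ N := measure_eq_zero_iff_ae_notMem.1 hN0
  refine ⟨fun s ω => if ω ∈ N then 0 else B s ω, fun s => Measurable.ite hNm measurable_const
    (hBm s), fun ω => ?_, hB.toIsPreBrownianReal.congr fun s => ?_, ?_⟩
  · by_cases hω : ω ∈ N
    · simpa [hω] using continuous_const
    · have : Continuous fun s => B s ω := by
        by_contra hc
        exact hω (hN hc)
      simpa [hω] using this
  · filter_upwards [hae] with ω hω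
    simp [hω]
  · filter_upwards [hae] with ω hω
    simp [hω]

lemma uHat_congr {B' : ℝ≥0 → Ω → ℝ} {ω : Ω} (h : ∀ s, B' s ω = B s ω) (t : ℝ≥0) (η r : ℝ) :
    uHat B' t η r ω = uHat B t η r ω := by
  simp only [uHat, h]

lemma uHat_ae_eq {B' : ℝ≥0 → Ω → ℝ} (h : ∀ᵐ ω ∂P, ∀ s, B' s ω = B s ω) (t : ℝ≥0) (η : ℝ)
    (ν : Measure ℝ) [SFinite ν] :
    (fun p : Ω × ℝ => uHat B' t η p.2 p.1) =ᵐ[P.prod ν] fun p => uHat B t η p.2 p.1 := by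
  filter_upwards [Measure.quasiMeasurePreserving_fst.ae h] with p hp
  exact uHat_congr hp t η p.2

/-- The process `uHat` is square integrable, with norm of order `h ^ 2`. -/
lemma exists_lintegral_enorm_uHat_sq_le [IsProbabilityMeasure P] (hBm : ∀ s, Measurable (B s))
    (hB : IsBrownianReal B P) (t : ℝ≥0) :
    ∃ C : ℝ, 0 < C ∧ ∀ h : ℝ, 0 < h →
      AEStronglyMeasurable (fun p : Ω × ℝ => uHat B t h p.2 p.1)
        (P.prod (volume.restrict (Set.Icc 0 (t : ℝ)))) ∧
      ∫⁻ p : Ω × ℝ, ‖uHat B t h p.2 p.1‖ₑ ^ 2 ∂(P.prod (volume.restrict (Set.Icc 0 (t : ℝ))))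
        ≤ ENNReal.ofReal (C * h ^ 4) := by
  obtain ⟨B', hm, hc, hB', hae⟩ := exists_continuous_modification hBm hB
  have hBm' := measurable_uncurry_of_continuous hm hc
  obtain ⟨C, hC, H⟩ := exists_lintegral_enorm_uHat_sq_le_of_continuous hB' hBm' t
  refine ⟨C, hC, fun h hh => ⟨?_, ?_⟩⟩
  · exact (measurable_uHat hBm' t h).aestronglyMeasurable.congr (uHat_ae_eq hae t h _)
  · refine le_trans (le_of_eq ?_) (H h hh)
    refine lintegral_congr_ae ?_
    filter_upwards [uHat_ae_eq hae t h (volume.restrict (Set.Icc 0 (t : ℝ)))] with p hp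
    rw [hp]


/-! ### The Itô isometry for elementary integrals -/

/-- The filtration generated by `B`. -/
abbrev generatedFiltration (hBm : ∀ s, Measurable (B s)) : Filtration ℝ≥0 mΩ :=
  Filtration.natural B (fun s => (hBm s).stronglyMeasurable)

lemma stronglyMeasurable_generatedFiltration (hBm : ∀ s, Measurable (B s)) {s c : ℝ≥0}
    (hs : s ≤ c) : StronglyMeasurable[generatedFiltration hBm c] (B s) :=
  ((Filtration.stronglyAdapted_natural (fun s => (hBm s).stronglyMeasurable)) s).mono
    ((generatedFiltration hBm).mono hs)

/-- The functional ψ sees the whole shifted path, so one statement covers a single increment after c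
and a product of two. -/
lemma indepFun_of_stronglyMeasurable (hBm : ∀ s, Measurable (B s)) (hB : IsPreBrownianReal B P)
    {c : ℝ≥0} {Y : Ω → ℝ} (hY : StronglyMeasurable[generatedFiltration hBm c] Y)
    {ψ : (ℝ≥0 → ℝ) → ℝ} (hψ : Measurable ψ) :
    IndepFun Y (fun ω => ψ fun s => B (c + s) ω - B c ω) P := by
  have h := ((hB.indepFun_shift c).comp (φ := ψ) (ψ := id) hψ measurable_id).symm
  rw [IndepFun_iff_Indep] at h ⊢
  refine indep_of_indep_of_le_left h ?_
  have := hY.measurable.comap_le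
  rwa [Filtration.natural_eq_comap] at this

lemma integral_increment (hB : IsPreBrownianReal B P) (c d : ℝ≥0) :
    ∫ ω, (B d ω - B c ω) ∂P = 0 := by
  rw [integral_sub (hB.integrable_eval d) (hB.integrable_eval c), hB.integral_eval,
    hB.integral_eval, sub_zero]

lemma memLp_eval (hB : IsPreBrownianReal B P) (c : ℝ≥0) : MemLp (B c) 2 P :=
  (hB.isGaussianProcess.hasGaussianLaw_eval c).memLp_two

lemma memLp_increment (hB : IsPreBrownianReal B P) (c d : ℝ≥0) :
    MemLp (fun ω => B d ω - B c ω) 2 P :=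
  (memLp_eval hB d).sub (memLp_eval hB c)

lemma integral_mul_increment (hBm : ∀ s, Measurable (B s)) (hB : IsPreBrownianReal B P)
    {c d : ℝ≥0} (hcd : c ≤ d) {Y : Ω → ℝ}
    (hY : StronglyMeasurable[generatedFiltration hBm c] Y) :
    ∫ ω, Y ω * (B d ω - B c ω) ∂P = 0 := by
  have hψ : Measurable fun x : ℝ≥0 → ℝ => x (d - c) := measurable_pi_apply _
  have h := indepFun_of_stronglyMeasurable hBm hB hY hψ
  simp only [add_tsub_cancel_of_le hcd] at h
  rw [h.integral_fun_mul_eq_mul_integral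
    (hY.mono ((generatedFiltration hBm).le c)).aestronglyMeasurable
    (memLp_increment hB c d).1, integral_increment hB, mul_zero]

lemma integral_mul_increment_mul_increment (hBm : ∀ s, Measurable (B s))
    (hB : IsPreBrownianReal B P) {b c d : ℝ≥0} (hcb : c ≤ b) (hcd : c ≤ d) {Y : Ω → ℝ}
    (hY : StronglyMeasurable[generatedFiltration hBm c] Y) :
    ∫ ω, Y ω * ((B b ω - B c ω) * (B d ω - B c ω)) ∂P = (∫ ω, Y ω ∂P) * (min b d - c) := by
  have : IsProbabilityMeasure P := hB.isGaussianProcess.isProbabilityMeasure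
  have h1 : Measurable fun x : ℝ≥0 → ℝ => x (b - c) := measurable_pi_apply _
  have h2 : Measurable fun x : ℝ≥0 → ℝ => x (d - c) := measurable_pi_apply _
  have h := indepFun_of_stronglyMeasurable hBm hB hY (h1.mul h2)
  simp only [Pi.mul_apply, add_tsub_cancel_of_le hcd, add_tsub_cancel_of_le hcb] at h
  rw [h.integral_fun_mul_eq_mul_integral
    (hY.mono ((generatedFiltration hBm).le c)).aestronglyMeasurable
    ((memLp_increment hB c b).1.mul (memLp_increment hB c d).1)]
  congr 1
  have hcov := (hB.shift c).covariance_eval (b - c) (d - c)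
  simp only [add_tsub_cancel_of_le hcd, add_tsub_cancel_of_le hcb] at hcov
  rw [covariance_eq_sub (memLp_increment hB c b) (memLp_increment hB c d),
    integral_increment hB, zero_mul, sub_zero] at hcov
  refine hcov.trans ?_
  rw [NNReal.coe_min, NNReal.coe_sub hcb, NNReal.coe_sub hcd, min_sub_sub_right, NNReal.coe_min]

lemma integrable_mul_increments (hB : IsPreBrownianReal B P) {Y : Ω → ℝ}
    (hY : AEStronglyMeasurable Y P) {K : ℝ} (hK : ∀ ω, |Y ω| ≤ K) (a b c d : ℝ≥0) :
    Integrable (fun ω => Y ω * ((B b ω - B a ω) * (B d ω - B c ω))) P :=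
  ((memLp_increment hB a b).integrable_mul (memLp_increment hB c d)).bdd_mul hY
    (Eventually.of_forall hK)

/-- Covariance of two increments with adapted coefficients. -/
lemma integral_coeff_increment_mul (hBm : ∀ s, Measurable (B s))
    (hB : IsPreBrownianReal B P) {a b c d : ℝ≥0} (hab : a ≤ b) (hcd : c ≤ d) {ξ η : Ω → ℝ}
    (hξ : StronglyMeasurable[generatedFiltration hBm a] ξ)
    (hη : StronglyMeasurable[generatedFiltration hBm c] η)
    {K L : ℝ} (hK : ∀ ω, |ξ ω| ≤ K) (hL : ∀ ω, |η ω| ≤ L) :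
    ∫ ω, (ξ ω * (B b ω - B a ω)) * (η ω * (B d ω - B c ω)) ∂P
      = (∫ ω, ξ ω * η ω ∂P) * volume.real (Set.Ioc (a : ℝ) b ∩ Set.Ioc (c : ℝ) d) := by
  -- The statement is symmetric in the two increments, so the first interval may be taken to start
  -- first.
  wlog hac : a ≤ c generalizing a b c d ξ η K L
  · have := this hcd hab hη hξ hL hK (le_of_not_ge hac)
    rw [Set.inter_comm]
    simp_rw [mul_comm (ξ _) (η _)]
    rw [← this]
    simp_rw [mul_comm (η _ * _)]
  have hprod : StronglyMeasurable[generatedFiltration hBm c] fun ω => ξ ω * η ω :=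
    (hξ.mono ((generatedFiltration hBm).mono hac)).mul hη
  have hpm := (hprod.mono ((generatedFiltration hBm).le c)).aestronglyMeasurable (μ := P)
  have hbd : ∀ ω, |ξ ω * η ω| ≤ K * L := fun ω => by
    rw [abs_mul]
    exact mul_le_mul (hK ω) (hL ω) (abs_nonneg _) ((abs_nonneg _).trans (hK ω))
  -- The first increment is cut at time c. The part before c is known at c and is killed by the zero
  -- mean of the second increment; the part after c yields the length of the overlap, and vanishes
  -- if b ≤ c.
  have hsplit : ∀ ω, (ξ ω * (B b ω - B a ω)) * (η ω * (B d ω - B c ω))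
      = ξ ω * η ω * ((B (min b c) ω - B a ω) * (B d ω - B c ω))
        + ξ ω * η ω * ((B (max b c) ω - B c ω) * (B d ω - B c ω)) := fun ω => by
    rcases le_total b c with h | h
    · rw [min_eq_left h, max_eq_right h]; ring
    · rw [min_eq_right h, max_eq_left h]; ring
  simp_rw [hsplit]
  rw [integral_add (integrable_mul_increments hB hpm hbd _ _ _ _)
    (integrable_mul_increments hB hpm hbd _ _ _ _),
    integral_mul_increment_mul_increment hBm hB (le_max_right b c) hcd hprod]
  have h0 : ∫ ω, ξ ω * η ω * ((B (min b c) ω - B a ω) * (B d ω - B c ω)) ∂P = 0 := by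
    simp_rw [← mul_assoc]
    refine integral_mul_increment hBm hB hcd (hprod.mul ?_)
    exact (stronglyMeasurable_generatedFiltration hBm (min_le_right _ _)).sub
      (stronglyMeasurable_generatedFiltration hBm hac)
  rw [h0, zero_add, Set.Ioc_inter_Ioc, Real.volume_real_Ioc]
  congr 1
  have e1 : (a : ℝ) ≤ c := hac
  have e2 : (c : ℝ) ≤ d := hcd
  rw [NNReal.coe_min, NNReal.coe_max, max_eq_right e1]
  rcases le_total (b : ℝ) c with h | h
  · rw [max_eq_right h, min_eq_left e2, min_eq_left (h.trans e2), max_eq_right (by linarith),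
      sub_self]
  · rw [max_eq_left h, max_eq_left (sub_nonneg.2 (le_min h e2))]

section Elementary

variable {ι : Type*} [Fintype ι]

lemma memLp_elementary_integral [IsFiniteMeasure P] (hB : IsPreBrownianReal B P) {a b : ι → ℝ≥0}
    {ξ : ι → Ω → ℝ} (hξ : ∀ i, StronglyMeasurable (ξ i)) (hK : ∀ i, ∃ K : ℝ, ∀ ω, |ξ i ω| ≤ K) :
    MemLp (fun ω => ∑ i, ξ i ω * (B (b i) ω - B (a i) ω)) 2 P := by
  refine memLp_finsetSum _ fun i _ => ?_
  obtain ⟨K, hK⟩ := hK i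
  exact (memLp_increment hB (a i) (b i)).mul (p := ∞) (q := 2)
    (memLp_top_of_bound (hξ i).aestronglyMeasurable K (Eventually.of_forall hK))

lemma memLp_elementary_process [IsFiniteMeasure P] {a b : ι → ℝ≥0} {ξ : ι → Ω → ℝ}
    (hξ : ∀ i, StronglyMeasurable (ξ i)) (hK : ∀ i, ∃ K : ℝ, ∀ ω, |ξ i ω| ≤ K)
    (ν : Measure ℝ) [IsFiniteMeasure ν] :
    MemLp (fun p : Ω × ℝ => ∑ i, ξ i p.1 * (Set.Ioc (a i : ℝ) (b i)).indicator 1 p.2) 2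
      (P.prod ν) := by
  refine memLp_finsetSum _ fun i _ => ?_
  obtain ⟨K, hK⟩ := hK i
  refine MemLp.of_bound (C := K) ?_ (Eventually.of_forall fun p => ?_)
  · exact (((hξ i).measurable.comp measurable_fst).mul
      ((measurable_one.indicator measurableSet_Ioc).comp measurable_snd)).aestronglyMeasurable
  · rw [norm_mul]
    have h1 : ‖(Set.Ioc (a i : ℝ) (b i)).indicator (1 : ℝ → ℝ) p.2‖ ≤ 1 := by
      by_cases h : p.2 ∈ Set.Ioc (a i : ℝ) (b i) <;> simp [h]
    calc _ ≤ K * 1 := mul_le_mul (hK _) h1 (norm_nonneg _) ((abs_nonneg _).trans (hK p.1))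
      _ = K := mul_one K

lemma eLpNorm_two_eq_of_integral_sq_eq {α β : Type*} {mα : MeasurableSpace α}
    {mβ : MeasurableSpace β} {μ : Measure α} {ν : Measure β} {f : α → ℝ} {g : β → ℝ}
    (hf : MemLp f 2 μ) (hg : MemLp g 2 ν) (h : ∫ x, f x ^ 2 ∂μ = ∫ x, g x ^ 2 ∂ν) :
    eLpNorm f 2 μ = eLpNorm g 2 ν := by
  rw [hf.eLpNorm_eq_integral_rpow_norm two_ne_zero (by simp),
    hg.eLpNorm_eq_integral_rpow_norm two_ne_zero (by simp)]
  simp [h]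

/-- **Itô isometry** for finite families of adapted coefficients on arbitrary intervals. -/
lemma eLpNorm_elementary_integral_eq [IsProbabilityMeasure P] (hBm : ∀ s, Measurable (B s))
    (hB : IsPreBrownianReal B P) {a b : ι → ℝ≥0} {t : ℝ≥0} (hab : ∀ i, a i ≤ b i)
    (hbt : ∀ i, b i ≤ t) {ξ : ι → Ω → ℝ}
    (hξ : ∀ i, StronglyMeasurable[generatedFiltration hBm (a i)] (ξ i))
    (hK : ∀ i, ∃ K : ℝ, ∀ ω, |ξ i ω| ≤ K) :
    eLpNorm (fun ω => ∑ i, ξ i ω * (B (b i) ω - B (a i) ω)) 2 P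
      = eLpNorm (fun p : Ω × ℝ => ∑ i, ξ i p.1 * (Set.Ioc (a i : ℝ) (b i)).indicator 1 p.2) 2
        (P.prod (volume.restrict (Set.Icc 0 (t : ℝ)))) := by
  have hξ' : ∀ i, StronglyMeasurable (ξ i) := fun i =>
    (hξ i).mono ((generatedFiltration hBm).le (a i))
  refine eLpNorm_two_eq_of_integral_sq_eq (memLp_elementary_integral hB hξ' hK)
    (memLp_elementary_process hξ' hK _) ?_
  have e1 : ∀ i, MemLp (fun ω => ξ i ω * (B (b i) ω - B (a i) ω)) 2 P := fun i => by
    simpa using memLp_elementary_integral (ι := Unit) (a := fun _ => a i) (b := fun _ => b i) hB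
      (fun _ => hξ' i) (fun _ => hK i)
  have e2 : ∀ i, MemLp (fun p : Ω × ℝ => ξ i p.1 * (Set.Ioc (a i : ℝ) (b i)).indicator 1 p.2) 2
      (P.prod (volume.restrict (Set.Icc 0 (t : ℝ)))) := fun i => by
    simpa using memLp_elementary_process (ι := Unit) (a := fun _ => a i) (b := fun _ => b i)
      (fun _ => hξ' i) (fun _ => hK i) (volume.restrict (Set.Icc 0 (t : ℝ)))
  have i1 : ∀ i j, Integrable (fun ω => ξ i ω * (B (b i) ω - B (a i) ω) *
      (ξ j ω * (B (b j) ω - B (a j) ω))) P := fun i j => (e1 i).integrable_mul (e1 j)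
  have i2 : ∀ i j, Integrable (fun p : Ω × ℝ =>
      ξ i p.1 * (Set.Ioc (a i : ℝ) (b i)).indicator 1 p.2 *
      (ξ j p.1 * (Set.Ioc (a j : ℝ) (b j)).indicator 1 p.2))
      (P.prod (volume.restrict (Set.Icc 0 (t : ℝ)))) := fun i j => (e2 i).integrable_mul (e2 j)
  -- Both squares expand into double sums that agree term by term: each side is E[ξ_i ξ_j] times the
  -- length of the overlap of the intervals. No disjointness is required.
  simp_rw [sq, Finset.sum_mul_sum]
  rw [integral_finsetSum _ fun i _ => integrable_finsetSum _ fun j _ =>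
      i1 i j,
    integral_finsetSum _ fun i _ => integrable_finsetSum _ fun j _ =>
      i2 i j]
  refine Finset.sum_congr rfl fun i _ => ?_
  rw [integral_finsetSum _ fun j _ => i1 i j,
    integral_finsetSum _ fun j _ => i2 i j]
  refine Finset.sum_congr rfl fun j _ => ?_
  obtain ⟨K, hKi⟩ := hK i
  obtain ⟨L, hLj⟩ := hK j
  rw [integral_coeff_increment_mul hBm hB (hab i) (hab j) (hξ i) (hξ j) hKi hLj]
  simp_rw [mul_mul_mul_comm (ξ i _)]
  rw [integral_prod_mul (fun ω => ξ i ω * ξ j ω) (fun s : ℝ =>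
    (Set.Ioc (a i : ℝ) (b i)).indicator 1 s * (Set.Ioc (a j : ℝ) (b j)).indicator 1 s)]
  congr 1
  have hm : MeasurableSet (Set.Ioc (a i : ℝ) (b i) ∩ Set.Ioc (a j : ℝ) (b j)) :=
    measurableSet_Ioc.inter measurableSet_Ioc
  have hsub : Set.Ioc (a i : ℝ) (b i) ∩ Set.Ioc (a j : ℝ) (b j) ⊆ Set.Icc 0 (t : ℝ) := fun s hs =>
    ⟨(a i).2.trans hs.1.1.le, hs.1.2.trans (by exact_mod_cast hbt i)⟩
  have e3 : (fun s : ℝ => (Set.Ioc (a i : ℝ) (b i)).indicator (1 : ℝ → ℝ) s *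
      (Set.Ioc (a j : ℝ) (b j)).indicator 1 s)
      = (Set.Ioc (a i : ℝ) (b i) ∩ Set.Ioc (a j : ℝ) (b j)).indicator 1 := by
    rw [Set.inter_indicator_one]
    rfl
  rw [e3, integral_indicator_one hm, measureReal_restrict_apply hm,
    Set.inter_eq_self_of_subset_left hsub]

end Elementary

namespace SimpleProcess

/-- The coefficients of a simple process, set to zero at the times after `t`. -/
noncomputable def stoppedCoeff {𝓕 : Filtration ℝ≥0 mΩ} (V : SimpleProcess 𝓕) (t : ℝ≥0) (i : ℕ)
    (ω : Ω) : ℝ :=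
  if V.time i ≤ t then V.coeff i ω else 0

/-- After clipping at t the coefficient must be measurable at time min(t_i, t). For t_i > t this
could fail, which is why the coefficient is then set to zero; the clipped interval is empty anyway.
-/
lemma stronglyMeasurable_stoppedCoeff {𝓕 : Filtration ℝ≥0 mΩ} (V : SimpleProcess 𝓕) (t : ℝ≥0)
    (i : ℕ) : StronglyMeasurable[𝓕 (min (V.time i) t)] (V.stoppedCoeff t i) := by
  unfold stoppedCoeff
  split_ifs with h
  · rw [min_eq_left h]
    exact V.coeff_meas i
  · exact stronglyMeasurable_const

lemma stoppedCoeff_bdd {𝓕 : Filtration ℝ≥0 mΩ} (V : SimpleProcess 𝓕) (t : ℝ≥0) (i : ℕ) :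
    ∃ K : ℝ, ∀ ω, |V.stoppedCoeff t i ω| ≤ K := by
  unfold stoppedCoeff
  split_ifs with h
  · exact V.coeff_bdd i
  · exact ⟨0, by simp⟩

lemma integral_eq_sum_stopped {𝓕 : Filtration ℝ≥0 mΩ} (V : SimpleProcess 𝓕) (B : ℝ≥0 → Ω → ℝ)
    (t : ℝ≥0) (ω : Ω) :
    V.integral B t ω = ∑ i : Fin V.n, V.stoppedCoeff t i ω *
      (B (min (V.time (i + 1)) t) ω - B (min (V.time i) t) ω) := by
  rw [integral, Finset.sum_range]
  refine Finset.sum_congr rfl fun i _ => ?_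
  unfold stoppedCoeff
  split_ifs with h
  · rfl
  · have h1 : t ≤ V.time i := le_of_not_ge h
    rw [min_eq_right h1, min_eq_right (h1.trans (V.time_mono (Nat.le_succ _))), sub_self, mul_zero,
      mul_zero]

lemma eval_eq_sum_stopped {𝓕 : Filtration ℝ≥0 mΩ} (V : SimpleProcess 𝓕) {t : ℝ≥0} {s : ℝ}
    (hs : s ≤ t) (ω : Ω) :
    V.eval s ω = ∑ i : Fin V.n, V.stoppedCoeff t i ω *
      (Set.Ioc ((min (V.time i) t : ℝ≥0) : ℝ) (min (V.time (i + 1)) t : ℝ≥0)).indicator 1 s := by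
  rw [eval, Finset.sum_range]
  refine Finset.sum_congr rfl fun i _ => ?_
  by_cases h : V.time i ≤ t
  · simp [stoppedCoeff, h, Set.indicator_apply, hs]
  · have h1 : ¬ (V.time i : ℝ) < s := fun h1 => h (by exact_mod_cast h1.le.trans hs)
    simp [stoppedCoeff, h, Set.indicator_apply, h1]

lemma memLp_integral [IsFiniteMeasure P] {𝓕 : Filtration ℝ≥0 mΩ} (hB : IsPreBrownianReal B P)
    (V : SimpleProcess 𝓕) (t : ℝ≥0) : MemLp (V.integral B t) 2 P := by
  refine (memLp_elementary_integral hB (ι := Fin V.n)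
    (a := fun i => min (V.time i) t) (b := fun i => min (V.time (i + 1)) t)
    (fun i => (V.stronglyMeasurable_stoppedCoeff t i).mono (𝓕.le _))
    (fun i => V.stoppedCoeff_bdd t i)).ae_eq (Eventually.of_forall fun ω => ?_)
  exact (V.integral_eq_sum_stopped B t ω).symm

/-- **Itô isometry** for the difference of two simple processes. -/
lemma eLpNorm_integral_sub [IsProbabilityMeasure P] (hBm : ∀ s, Measurable (B s))
    (hB : IsPreBrownianReal B P) (V W : SimpleProcess (generatedFiltration hBm)) (t : ℝ≥0) :
    eLpNorm (fun ω => V.integral B t ω - W.integral B t ω) 2 P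
      = eLpNorm (fun p : Ω × ℝ => V.eval p.2 p.1 - W.eval p.2 p.1) 2
        (P.prod (volume.restrict (Set.Icc 0 (t : ℝ)))) := by
  have hmono : ∀ U : SimpleProcess (generatedFiltration hBm), ∀ i,
      min (U.time i) t ≤ min (U.time (i + 1)) t := fun U i =>
    min_le_min_right _ (U.time_mono (Nat.le_succ i))
  -- The two families are concatenated, the second with a minus sign. Since overlapping intervals
  -- are allowed, no common refinement of the partitions is needed.
  have key := eLpNorm_elementary_integral_eq (ι := Fin V.n ⊕ Fin W.n) hBm hB (t := t)
    (a := Sum.elim (fun i => min (V.time i) t) fun i => min (W.time i) t)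
    (b := Sum.elim (fun i => min (V.time (i + 1)) t) fun i => min (W.time (i + 1)) t)
    (ξ := Sum.elim (fun i => V.stoppedCoeff t i) fun i => -W.stoppedCoeff t i)
    (by rintro (i | i) <;> exact hmono _ _) (by rintro (i | i) <;> exact min_le_right _ _)
    (by
      rintro (i | i)
      · exact V.stronglyMeasurable_stoppedCoeff t i
      · exact (W.stronglyMeasurable_stoppedCoeff t i).neg)
    (by
      rintro (i | i)
      · exact V.stoppedCoeff_bdd t i
      · simpa using W.stoppedCoeff_bdd t i)
  have hae : ∀ᵐ p : Ω × ℝ ∂(P.prod (volume.restrict (Set.Icc 0 (t : ℝ)))),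
      p.2 ∈ Set.Icc 0 (t : ℝ) :=
    Measure.quasiMeasurePreserving_snd.ae (ae_restrict_mem measurableSet_Icc)
  calc _ = _ := by
        refine congrArg (fun f => eLpNorm f 2 P) (funext fun ω => ?_)
        rw [V.integral_eq_sum_stopped, W.integral_eq_sum_stopped]
        symm
        simp [Fintype.sum_sum_type, sub_eq_add_neg]
    _ = _ := key
    _ = _ := by
        refine eLpNorm_congr_ae ?_
        filter_upwards [hae] with p hp
        rw [V.eval_eq_sum_stopped hp.2, W.eval_eq_sum_stopped hp.2]
        simp [Fintype.sum_sum_type, sub_eq_add_neg]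

/-- The simple process without steps. -/
def empty (𝓕 : Filtration ℝ≥0 mΩ) : SimpleProcess 𝓕 where
  n := 0
  time := fun _ => 0
  coeff := fun _ _ => 0
  time_mono := monotone_const
  coeff_meas := fun _ => stronglyMeasurable_const
  coeff_bdd := fun _ => ⟨0, by simp⟩

/-- **Itô isometry** for simple processes. -/
lemma eLpNorm_integral [IsProbabilityMeasure P] (hBm : ∀ s, Measurable (B s))
    (hB : IsPreBrownianReal B P) (V : SimpleProcess (generatedFiltration hBm)) (t : ℝ≥0) :
    eLpNorm (V.integral B t) 2 P = eLpNorm (fun p : Ω × ℝ => V.eval p.2 p.1) 2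
        (P.prod (volume.restrict (Set.Icc 0 (t : ℝ)))) := by
  have h := eLpNorm_integral_sub hBm hB V (empty _) t
  have h0 : ∀ ω, (empty (generatedFiltration hBm)).integral B t ω = 0 := fun ω => by
    simp [integral, empty]
  have h1 : ∀ s ω, (empty (generatedFiltration hBm)).eval s ω = 0 := fun s ω => by
    simp [eval, empty]
  simpa [h0, h1] using h

lemma measurable_eval {𝓕 : Filtration ℝ≥0 mΩ} (V : SimpleProcess 𝓕) :
    Measurable fun p : Ω × ℝ => V.eval p.2 p.1 := by
  unfold eval
  refine Finset.measurable_sum _ fun i _ => ?_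
  exact Measurable.ite (measurableSet_Ioc.preimage measurable_snd)
    (((V.coeff_meas i).mono (𝓕.le _)).measurable.comp measurable_fst) measurable_const

end SimpleProcess


/-! ### Convergence in `L²` -/

lemma eLpNorm_two_eq {α : Type*} {mα : MeasurableSpace α} (μ : Measure α) (f : α → ℝ) :
    eLpNorm f 2 μ = (∫⁻ x, ‖f x‖ₑ ^ 2 ∂μ) ^ (1 / 2 : ℝ) := by
  rw [eLpNorm_eq_lintegral_rpow_enorm_toReal two_ne_zero (by simp)]
  simp

lemma tendsto_eLpNorm_two_zero_of_dominated {α : Type*} {mα : MeasurableSpace α} {μ : Measure α}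
    {f : ℕ → α → ℝ} {g : α → ℝ} (hf : ∀ n, AEStronglyMeasurable (f n) μ) (hg : MemLp g 2 μ)
    (hle : ∀ n, ∀ᵐ x ∂μ, ‖f n x‖ ≤ ‖g x‖)
    (hlim : ∀ᵐ x ∂μ, Tendsto (fun n => f n x) atTop (𝓝 0)) :
    Tendsto (fun n => eLpNorm (f n) 2 μ) atTop (𝓝 0) := by
  have hgfin : ∫⁻ x, ‖g x‖ₑ ^ 2 ∂μ ≠ ∞ := by
    intro h
    have := hg.2
    rw [eLpNorm_two_eq, h] at this
    simp at this
  have h := tendsto_lintegral_of_dominated_convergence' (μ := μ) (F := fun n x => ‖f n x‖ₑ ^ 2)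
    (f := fun _ => 0) (fun x => ‖g x‖ₑ ^ 2) (fun n => (hf n).enorm.pow_const 2)
    (fun n => by
      filter_upwards [hle n] with x hx
      have : ‖f n x‖ₑ ≤ ‖g x‖ₑ := enorm_le_iff_norm_le.2 hx
      gcongr) hgfin
    (by
      filter_upwards [hlim] with x hx
      have h1 : Tendsto (fun n => ‖f n x‖ₑ) atTop (𝓝 0) := by
        have := (continuous_enorm.tendsto (0 : ℝ)).comp hx
        rwa [enorm_zero] at this
      simpa [Function.comp_def] using ((ENNReal.continuous_pow 2).tendsto 0).comp h1)
  simp_rw [eLpNorm_two_eq]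
  simp only [lintegral_zero] at h
  simpa using h.ennrpow_const (1 / 2)

lemma tendsto_eLpNorm_of_tendsto_sub {α : Type*} {mα : MeasurableSpace α} {μ : Measure α}
    {f : ℕ → α → ℝ} {g : α → ℝ} (hf : ∀ n, AEStronglyMeasurable (f n) μ) (hg : MemLp g 2 μ)
    (h : Tendsto (fun n => eLpNorm (fun x => f n x - g x) 2 μ) atTop (𝓝 0)) :
    Tendsto (fun n => eLpNorm (f n) 2 μ) atTop (𝓝 (eLpNorm g 2 μ)) := by
  have hsub : ∀ n, AEStronglyMeasurable (fun x => f n x - g x) μ := fun n => (hf n).sub hg.1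
  have h1 : ∀ n, eLpNorm (f n) 2 μ ≤ eLpNorm g 2 μ + eLpNorm (fun x => f n x - g x) 2 μ :=
    fun n => by
      calc eLpNorm (f n) 2 μ = eLpNorm (g + fun x => f n x - g x) 2 μ := by
            congr 1; ext x; simp
        _ ≤ _ := eLpNorm_add_le hg.1 (hsub n) (by norm_num)
  have h2 : ∀ n, eLpNorm g 2 μ - eLpNorm (fun x => f n x - g x) 2 μ ≤ eLpNorm (f n) 2 μ :=
    fun n => by
      rw [tsub_le_iff_right]
      calc eLpNorm g 2 μ = eLpNorm (f n - fun x => f n x - g x) 2 μ := by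
            congr 1; ext x; simp
        _ ≤ _ := eLpNorm_sub_le (hf n) (hsub n) (by norm_num)
  refine tendsto_of_tendsto_of_tendsto_of_le_of_le (g := fun n => eLpNorm g 2 μ -
    eLpNorm (fun x => f n x - g x) 2 μ) (h := fun n => eLpNorm g 2 μ +
    eLpNorm (fun x => f n x - g x) 2 μ) ?_ ?_ h2 h1
  · simpa using ENNReal.Tendsto.sub tendsto_const_nhds h (Or.inl hg.2.ne)
  · simpa using tendsto_const_nhds.add h

/-! ### Left endpoints of a regular grid -/

/-- The index `i` with `s ∈ (i δ, (i + 1) δ]`, for `s > 0`. -/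
noncomputable def gridIndex (δ : ℝ≥0) (s : ℝ) : ℕ := ⌈s / δ⌉₊ - 1

/-- The left endpoint of the interval `(i δ, (i + 1) δ]` that contains `s > 0`. -/
noncomputable def gridLeft (δ : ℝ≥0) (s : ℝ) : ℝ≥0 := gridIndex δ s * δ

lemma gridLeft_lt {δ : ℝ≥0} (hδ : 0 < δ) {s : ℝ} (hs : 0 < s) : (gridLeft δ s : ℝ) < s := by
  have hδ' : (0 : ℝ) < δ := hδ
  have h1 : 0 < ⌈s / δ⌉₊ := Nat.ceil_pos.2 (by positivity)
  have h2 : ((⌈s / δ⌉₊ - 1 : ℕ) : ℝ) < s / δ := Nat.lt_ceil.1 (by omega)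
  rw [gridLeft, NNReal.coe_mul, NNReal.coe_natCast]
  exact (lt_div_iff₀ hδ').1 h2

lemma le_gridLeft_add {δ : ℝ≥0} (hδ : 0 < δ) (s : ℝ) : s ≤ gridLeft δ s + δ := by
  have hδ' : (0 : ℝ) < δ := hδ
  have h2 : s / δ ≤ (gridIndex δ s + 1 : ℕ) := by
    refine (Nat.le_ceil _).trans ?_
    unfold gridIndex
    exact_mod_cast (by omega)
  have := (div_le_iff₀ hδ').1 h2
  rw [gridLeft, NNReal.coe_mul, NNReal.coe_natCast]
  push_cast at this
  linarith

/-- Ceiling minus one, rather than floor, matches the left-open intervals of simple processes. -/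
lemma gridIndex_eq {δ : ℝ≥0} (hδ : 0 < δ) {i : ℕ} {s : ℝ} (h1 : i * (δ : ℝ) < s)
    (h2 : s ≤ (i + 1 : ℕ) * (δ : ℝ)) : gridIndex δ s = i := by
  have hδ' : (0 : ℝ) < δ := hδ
  have e : ⌈s / δ⌉₊ = i + 1 := by
    rw [Nat.ceil_eq_iff (by omega)]
    refine ⟨?_, (div_le_iff₀ hδ').2 h2⟩
    rw [lt_div_iff₀ hδ']
    simpa using h1
  rw [gridIndex, e, Nat.add_sub_cancel]

lemma measurable_gridLeft (δ : ℝ≥0) : Measurable (gridLeft δ) := by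
  have h : Measurable (gridIndex δ) :=
    (measurable_from_nat (f := fun n => n - 1)).comp
      (Nat.measurable_ceil.comp (measurable_id.div_const _))
  exact (measurable_from_nat (f := fun n => (n : ℝ≥0) * δ)).comp h

lemma tendsto_gridLeft {δ : ℕ → ℝ≥0} (hδ : ∀ n, 0 < δ n) (hlim : Tendsto δ atTop (𝓝 0)) {s : ℝ}
    (hs : 0 < s) : Tendsto (fun n => gridLeft (δ n) s) atTop (𝓝 s.toNNReal) := by
  rw [← NNReal.tendsto_coe, Real.coe_toNNReal _ hs.le]
  have hlim' : Tendsto (fun n => s - (δ n : ℝ)) atTop (𝓝 s) := by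
    simpa using tendsto_const_nhds.sub (NNReal.tendsto_coe.2 hlim)
  exact tendsto_of_tendsto_of_tendsto_of_le_of_le hlim' tendsto_const_nhds
    (fun n => by linarith [le_gridLeft_add (hδ n) s]) fun n => (gridLeft_lt (hδ n) hs).le

/-! ### Approximation of path integrals by simple processes -/

section PathIntegral

variable {F : ℝ → ℝ → ℝ} {M : ℝ}

/-- The simple process on the grid of step `δ` whose coefficients are the left Riemann sums of
`u ↦ F s (B_s - B_u)` on `[0, s]`. -/
noncomputable def riemannProcess (hBm : ∀ s, Measurable (B s))
    (hF : Continuous (Function.uncurry F)) (hM : ∀ s x, |F s x| ≤ M) (δ : ℝ≥0) (n : ℕ) :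
    SimpleProcess (generatedFiltration hBm) where
  n := n
  time := fun i => i * δ
  coeff := fun i ω => ∑ j ∈ Finset.range i,
    (δ : ℝ) * F ((i * δ : ℝ≥0) : ℝ) (B (i * δ) ω - B (j * δ) ω)
  time_mono := fun i j hij => by
    have : (i : ℝ≥0) ≤ j := by exact_mod_cast hij
    exact mul_le_mul' this le_rfl
  coeff_meas := fun i => by
    refine Finset.stronglyMeasurable_fun_sum _ fun j hj => ?_
    have hji : (j : ℝ≥0) ≤ i := by exact_mod_cast (Finset.mem_range.1 hj).le
    have hFi : Continuous (F ((i * δ : ℝ≥0) : ℝ)) := hF.comp (Continuous.prodMk_right _)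
    refine StronglyMeasurable.const_mul (hFi.comp_stronglyMeasurable ?_) _
    exact (stronglyMeasurable_generatedFiltration hBm le_rfl).sub
      (stronglyMeasurable_generatedFiltration hBm (by gcongr))
  coeff_bdd := fun i => ⟨∑ j ∈ Finset.range i, (δ : ℝ) * M, fun ω => by
    refine (Finset.abs_sum_le_sum_abs _ _).trans (Finset.sum_le_sum fun j _ => ?_)
    rw [abs_mul, abs_of_nonneg (NNReal.coe_nonneg δ)]
    exact mul_le_mul_of_nonneg_left (hM _ _) δ.2⟩

/-- Writing the Riemann sum as the integral of a step function lets dominated convergence replace an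
error estimate. -/
lemma riemannProcess_coeff_eq (hBm : ∀ s, Measurable (B s))
    (hF : Continuous (Function.uncurry F)) (hM : ∀ s x, |F s x| ≤ M) {δ : ℝ≥0} (hδ : 0 < δ)
    (n i : ℕ) (ω : Ω) :
    (riemannProcess hBm hF hM δ n).coeff i ω
      = ∫ u in (0 : ℝ)..(i * δ : ℝ≥0), F ((i * δ : ℝ≥0) : ℝ)
        (B (i * δ) ω - B (gridLeft δ u) ω) := by
  have hle : ∀ j : ℕ, (j : ℝ) * δ ≤ (j + 1 : ℕ) * δ := fun j => by
    have := δ.2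
    push_cast
    nlinarith
  have hcongr : ∀ j : ℕ, Set.EqOn
      (fun u : ℝ => F ((i * δ : ℝ≥0) : ℝ) (B (i * δ) ω - B (gridLeft δ u) ω))
      (fun _ => F ((i * δ : ℝ≥0) : ℝ) (B (i * δ) ω - B (j * δ) ω))
      (Set.uIoc ((j : ℝ) * δ) ((j + 1 : ℕ) * δ)) := fun j u hu => by
    rw [Set.uIoc_of_le (hle j)] at hu
    simp only [gridLeft, gridIndex_eq hδ hu.1 hu.2]
  have hsum := intervalIntegral.sum_integral_adjacent_intervals (μ := volume)
    (f := fun u : ℝ => F ((i * δ : ℝ≥0) : ℝ) (B (i * δ) ω - B (gridLeft δ u) ω))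
    (a := fun j : ℕ => (j : ℝ) * δ) (n := i) (fun j _ =>
      (intervalIntegrable_const (c := F ((i * δ : ℝ≥0) : ℝ)
        (B (i * δ) ω - B (j * δ) ω))).congr (hcongr j).symm)
  rw [Nat.cast_zero, zero_mul] at hsum
  change (∑ j ∈ Finset.range i,
    (δ : ℝ) * F ((i * δ : ℝ≥0) : ℝ) (B (i * δ) ω - B (j * δ) ω)) = _
  rw [NNReal.coe_mul, NNReal.coe_natCast] at hsum ⊢
  rw [← hsum]
  refine Finset.sum_congr rfl fun j _ => ?_
  have := hcongr j
  rw [NNReal.coe_mul, NNReal.coe_natCast] at this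
  rw [intervalIntegral.integral_congr_ae (Eventually.of_forall fun u hu => this hu),
    intervalIntegral.integral_const, smul_eq_mul]
  congr 1
  push_cast
  ring

lemma riemannProcess_eval_eq (hBm : ∀ s, Measurable (B s))
    (hF : Continuous (Function.uncurry F)) (hM : ∀ s x, |F s x| ≤ M) {δ : ℝ≥0} (hδ : 0 < δ)
    {n : ℕ} {s : ℝ} (hs : 0 < s) (hsn : s ≤ n * δ) (ω : Ω) :
    (riemannProcess hBm hF hM δ n).eval s ω
      = ∫ u in (0 : ℝ)..gridLeft δ s, F (gridLeft δ s)
        (B (gridLeft δ s) ω - B (gridLeft δ u) ω) := by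
  have hδ' : (0 : ℝ) < δ := hδ
  have h1 := gridLeft_lt hδ hs
  have h2 := le_gridLeft_add hδ s
  rw [gridLeft, NNReal.coe_mul, NNReal.coe_natCast] at h1 h2
  have hlt : gridIndex δ s < n := by
    have : (gridIndex δ s : ℝ) < n := lt_of_mul_lt_mul_right (h1.trans_le hsn) hδ'.le
    exact_mod_cast this
  rw [SimpleProcess.eval, Finset.sum_eq_single (gridIndex δ s)]
  · rw [Set.indicator_of_mem]
    · exact riemannProcess_coeff_eq hBm hF hM hδ n _ ω
    · refine ⟨by simpa [riemannProcess] using h1, ?_⟩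
      simp only [riemannProcess]
      push_cast
      linarith
  · intro j _ hj
    refine Set.indicator_of_notMem (fun hmem => hj ?_) _
    refine (gridIndex_eq hδ ?_ ?_).symm
    · simpa [riemannProcess] using hmem.1
    · simpa [riemannProcess] using hmem.2
  · intro h
    exact absurd (Finset.mem_range.2 hlt) h

lemma riemannProcess_eval_eq_zero (hBm : ∀ s, Measurable (B s))
    (hF : Continuous (Function.uncurry F)) (hM : ∀ s x, |F s x| ≤ M) {δ : ℝ≥0}
    {n : ℕ} {s : ℝ} (hsn : n * δ < s) (ω : Ω) :
    (riemannProcess hBm hF hM δ n).eval s ω = 0 := by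
  refine Finset.sum_eq_zero fun i hi => Set.indicator_of_notMem (fun hmem => ?_) _
  have h1 : (i + 1 : ℕ) ≤ (n : ℝ) := by exact_mod_cast Finset.mem_range.1 hi
  have h2 : s ≤ (i + 1 : ℕ) * δ := by simpa [riemannProcess] using hmem.2
  have := mul_le_mul_of_nonneg_right h1 δ.2
  exact absurd (hsn.trans_le (h2.trans this)) (lt_irrefl _)

/-- Left endpoints converge to s and u, so continuity of the path and of F gives pointwise
convergence, and M on (0, s] dominates. -/
lemma tendsto_integral_gridLeft (hF : Continuous (Function.uncurry F)) (hM : ∀ s x, |F s x| ≤ M)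
    {δ : ℕ → ℝ≥0} (hδ : ∀ n, 0 < δ n) (hlim : Tendsto δ atTop (𝓝 0)) {b : ℝ≥0 → ℝ}
    (hb : Continuous b) {s : ℝ} (hs : 0 < s) :
    Tendsto (fun n => ∫ u in (0 : ℝ)..gridLeft (δ n) s, F (gridLeft (δ n) s)
        (b (gridLeft (δ n) s) - b (gridLeft (δ n) u))) atTop
      (𝓝 (∫ u in (0 : ℝ)..s, F s (b s.toNNReal - b u.toNNReal))) := by
  have hs' := tendsto_gridLeft hδ hlim hs
  have hsr : Tendsto (fun n => (gridLeft (δ n) s : ℝ)) atTop (𝓝 s) := by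
    have := NNReal.tendsto_coe.2 hs'
    rwa [Real.coe_toNNReal _ hs.le] at this
  have hcv : ∀ n, ∫ u in (0 : ℝ)..gridLeft (δ n) s, F (gridLeft (δ n) s)
        (b (gridLeft (δ n) s) - b (gridLeft (δ n) u))
      = ∫ u, (Set.Ioc 0 (gridLeft (δ n) s : ℝ)).indicator (fun u => F (gridLeft (δ n) s)
        (b (gridLeft (δ n) s) - b (gridLeft (δ n) u))) u := fun n => by
    rw [intervalIntegral.integral_of_le NNReal.zero_le_coe, integral_indicator measurableSet_Ioc]
  simp_rw [hcv]
  rw [intervalIntegral.integral_of_le hs.le, ← integral_indicator measurableSet_Ioc]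
  refine tendsto_integral_of_dominated_convergence
    ((Set.Ioc 0 s).indicator fun _ => M) (fun n => ?_) ?_ (fun n => ?_) ?_
  · refine (Measurable.indicator ?_ measurableSet_Ioc).aestronglyMeasurable
    have hFs : Continuous (F (gridLeft (δ n) s)) := hF.comp (Continuous.prodMk_right _)
    exact hFs.measurable.comp (measurable_const.sub
      (hb.measurable.comp (measurable_gridLeft (δ n))))
  · rw [integrable_indicator_iff measurableSet_Ioc]
    simp
  · refine Eventually.of_forall fun u => ?_
    by_cases hu : u ∈ Set.Ioc 0 (gridLeft (δ n) s : ℝ)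
    · have hu' : u ∈ Set.Ioc 0 s := ⟨hu.1, hu.2.trans (gridLeft_lt (hδ n) hs).le⟩
      rw [Set.indicator_of_mem hu, Set.indicator_of_mem hu']
      exact hM _ _
    · rw [Set.indicator_of_notMem hu, norm_zero]
      exact Set.indicator_nonneg (fun _ _ => (abs_nonneg _).trans (hM 0 0)) _
  -- At u = s the indicators are all zero while the limiting one is 1; this point is discarded.
  · have hne : ∀ᵐ u : ℝ, u ≠ s := by simp [ae_iff]
    filter_upwards [hne] with u hu
    by_cases hu0 : 0 < u
    · rcases lt_or_gt_of_ne hu with h | h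
      · rw [Set.indicator_of_mem (show u ∈ Set.Ioc 0 s from ⟨hu0, h.le⟩)]
        have hev : ∀ᶠ n in atTop, u ∈ Set.Ioc 0 (gridLeft (δ n) s : ℝ) := by
          filter_upwards [hsr.eventually (lt_mem_nhds h)] with n hn using ⟨hu0, hn.le⟩
        have hlimF : Tendsto (fun n => F (gridLeft (δ n) s)
            (b (gridLeft (δ n) s) - b (gridLeft (δ n) u))) atTop
            (𝓝 (F s (b s.toNNReal - b u.toNNReal))) := by
          have h2 : Tendsto (fun n => b (gridLeft (δ n) s) - b (gridLeft (δ n) u)) atTop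
              (𝓝 (b s.toNNReal - b u.toNNReal)) :=
            ((hb.tendsto _).comp hs').sub ((hb.tendsto _).comp (tendsto_gridLeft hδ hlim hu0))
          exact (hF.tendsto (s, b s.toNNReal - b u.toNNReal)).comp (hsr.prodMk_nhds h2)
        refine hlimF.congr' ?_
        filter_upwards [hev] with n hn
        rw [Set.indicator_of_mem hn]
      · have h1 : u ∉ Set.Ioc 0 s := fun hm => absurd hm.2 (not_le.2 h)
        have h2 : ∀ n, u ∉ Set.Ioc 0 (gridLeft (δ n) s : ℝ) := fun n hm =>
          absurd (hm.2.trans (gridLeft_lt (hδ n) hs).le) (not_le.2 h)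
        simp [Set.indicator_of_notMem h1, Set.indicator_of_notMem (h2 _)]
    · have h1 : u ∉ Set.Ioc 0 s := fun hm => hu0 hm.1
      have h2 : ∀ n, u ∉ Set.Ioc 0 (gridLeft (δ n) s : ℝ) := fun n hm => hu0 hm.1
      simp [Set.indicator_of_notMem h1, Set.indicator_of_notMem (h2 _)]

lemma abs_intervalIntegral_le {f : ℝ → ℝ} (hM : ∀ u, |f u| ≤ M) {s T : ℝ} (hs : 0 ≤ s)
    (hsT : s ≤ T) : |∫ u in (0 : ℝ)..s, f u| ≤ M * T := by
  have hM0 : 0 ≤ M := (abs_nonneg _).trans (hM 0)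
  have := intervalIntegral.norm_integral_le_of_norm_le_const (a := 0) (b := s) (f := f) (C := M)
    fun u _ => hM u
  rw [Real.norm_eq_abs, sub_zero, abs_of_nonneg hs] at this
  exact this.trans (mul_le_mul_of_nonneg_left hsT hM0)

/-- Path integrals of bounded continuous functions of the increments, stopped at `T`, are limits
of simple processes in `L²`. -/
lemma exists_simpleProcess_tendsto_pathIntegral [IsProbabilityMeasure P]
    (hBm : ∀ s, Measurable (B s)) (hB : IsBrownianReal B P)
    (hF : Continuous (Function.uncurry F)) (hM : ∀ s x, |F s x| ≤ M) {T t : ℝ≥0} (hT : 0 < T) :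
    ∃ V : ℕ → SimpleProcess (generatedFiltration hBm),
      AEStronglyMeasurable (fun p : Ω × ℝ => if p.2 ≤ T then
        ∫ u in (0 : ℝ)..p.2, F p.2 (B p.2.toNNReal p.1 - B u.toNNReal p.1) else 0)
        (P.prod (volume.restrict (Set.Icc 0 (t : ℝ)))) ∧
      Tendsto (fun k => eLpNorm (fun p : Ω × ℝ => (V k).eval p.2 p.1 - if p.2 ≤ T then
        ∫ u in (0 : ℝ)..p.2, F p.2 (B p.2.toNNReal p.1 - B u.toNNReal p.1) else 0) 2
        (P.prod (volume.restrict (Set.Icc 0 (t : ℝ))))) atTop (𝓝 0) := by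
  set ν := P.prod (volume.restrict (Set.Icc 0 (t : ℝ))) with hν
  set Y : Ω × ℝ → ℝ := fun p => if p.2 ≤ T then
        ∫ u in (0 : ℝ)..p.2, F p.2 (B p.2.toNNReal p.1 - B u.toNNReal p.1) else 0 with hY
  -- With n + 1 steps the grid ends exactly at T, so the simple processes vanish after T like the
  -- truncated target.
  set δ : ℕ → ℝ≥0 := fun n => T / (n + 1 : ℕ) with hδdef
  have hδ : ∀ n, 0 < δ n := fun n => by
    simp only [hδdef]
    positivity
  have hδn : ∀ n : ℕ, ((n + 1 : ℕ) : ℝ) * δ n = T := fun n => by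
    simp only [hδdef, NNReal.coe_div, NNReal.coe_natCast]
    field_simp
  have hlim : Tendsto δ atTop (𝓝 0) := by
    rw [← NNReal.tendsto_coe]
    have := tendsto_const_div_atTop_nhds_zero_nat (T : ℝ)
    have := this.comp (tendsto_add_atTop_nat 1)
    simpa [hδdef, Function.comp_def] using this
  set V : ℕ → SimpleProcess (generatedFiltration hBm) := fun n =>
    riemannProcess hBm hF hM (δ n) (n + 1) with hV
  have hpos : ∀ᵐ p ∂ν, 0 < p.2 := by
    have h0 : ∀ᵐ s ∂(volume.restrict (Set.Icc 0 (t : ℝ))), 0 < s := by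
      have hne : ∀ᵐ s ∂(volume.restrict (Set.Icc 0 (t : ℝ))), s ≠ (0 : ℝ) :=
        ae_restrict_of_ae (by simp [ae_iff])
      filter_upwards [ae_restrict_mem measurableSet_Icc, hne] with s hs hs0
      exact lt_of_le_of_ne hs.1 hs0.symm
    exact Measure.quasiMeasurePreserving_snd.ae h0
  have hcont : ∀ᵐ p ∂ν, Continuous fun s => B s p.1 :=
    Measure.quasiMeasurePreserving_fst.ae hB.cont
  have hM0 : 0 ≤ M := (abs_nonneg _).trans (hM 0 0)
  have hconv : ∀ᵐ p ∂ν, Tendsto (fun n => (V n).eval p.2 p.1) atTop (𝓝 (Y p)) := by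
    filter_upwards [hpos, hcont] with p hp hc
    by_cases hpT : p.2 ≤ T
    · have e : ∀ n, (V n).eval p.2 p.1 = ∫ u in (0 : ℝ)..gridLeft (δ n) p.2,
          F (gridLeft (δ n) p.2) (B (gridLeft (δ n) p.2) p.1 - B (gridLeft (δ n) u) p.1) :=
        fun n => riemannProcess_eval_eq hBm hF hM (hδ n) hp (by rw [hδn]; exact hpT) p.1
      simp only [hY, hpT, if_true]
      simp_rw [e]
      exact tendsto_integral_gridLeft hF hM hδ hlim hc hp
    · have e : ∀ n, (V n).eval p.2 p.1 = 0 := fun n =>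
        riemannProcess_eval_eq_zero hBm hF hM (by rw [hδn]; exact not_le.1 hpT) p.1
      simp only [hY, hpT, if_false, e]
      exact tendsto_const_nhds
  have hVm : ∀ n, AEStronglyMeasurable (fun p : Ω × ℝ => (V n).eval p.2 p.1) ν := fun n =>
    (V n).measurable_eval.aestronglyMeasurable
  have hYm : AEStronglyMeasurable Y ν := aestronglyMeasurable_of_tendsto_ae atTop hVm hconv
  refine ⟨V, hYm, tendsto_eLpNorm_two_zero_of_dominated (g := fun _ => M * T + M * T)
    (fun n => (hVm n).sub hYm) (memLp_const _) (fun n => ?_) ?_⟩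
  · filter_upwards [hpos] with p hp
    rw [Real.norm_of_nonneg (by positivity : 0 ≤ M * T + M * T)]
    by_cases hpT : p.2 ≤ T
    · refine (norm_sub_le _ _).trans (add_le_add ?_ ?_)
      · rw [riemannProcess_eval_eq hBm hF hM (hδ n) hp (by rw [hδn]; exact hpT) p.1]
        exact abs_intervalIntegral_le (fun u => hM _ _) NNReal.zero_le_coe
          ((gridLeft_lt (hδ n) hp).le.trans hpT)
      · simp only [hpT, if_true]
        exact abs_intervalIntegral_le (fun u => hM _ _) hp.le hpT
    · rw [riemannProcess_eval_eq_zero hBm hF hM (by rw [hδn]; exact not_le.1 hpT) p.1]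
      simp only [hpT, if_false, sub_self, norm_zero]
      positivity
  · filter_upwards [hconv] with p hp
    simpa using hp.sub_const (Y p)

end PathIntegral


/-! ### The Itô integral of `uHat` -/

/-- The approximations of a truncated `uHat` by simple processes. -/
lemma exists_simpleProcess_tendsto_uHat_truncated [IsProbabilityMeasure P]
    (hBm : ∀ s, Measurable (B s)) (hB : IsBrownianReal B P) {h : ℝ} (hh : 0 ≤ h) {T t : ℝ≥0}
    (hT : 0 < T) (hTt : T < t) :
    ∃ V : ℕ → SimpleProcess (generatedFiltration hBm),
      AEStronglyMeasurable (fun p : Ω × ℝ => if p.2 ≤ T then uHat B t h p.2 p.1 else 0)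
        (P.prod (volume.restrict (Set.Icc 0 (t : ℝ)))) ∧
      Tendsto (fun k => eLpNorm (fun p : Ω × ℝ => (V k).eval p.2 p.1 -
        if p.2 ≤ T then uHat B t h p.2 p.1 else 0) 2
        (P.prod (volume.restrict (Set.Icc 0 (t : ℝ))))) atTop (𝓝 0) := by
  have hε : (0 : ℝ) < t - T := sub_pos.2 (by exact_mod_cast hTt)
  -- The maximum keeps the time argument at least t - T > 0 for every s, which makes F bounded and
  -- continuous everywhere; it equals t - s for s ≤ T.
  set F : ℝ → ℝ → ℝ := fun s x => 4 * kernelDiff h (max (t - s) (t - T)) x with hF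
  have hFc : Continuous (Function.uncurry F) :=
    continuous_const.mul (continuous_kernelDiff h (f := fun q : ℝ × ℝ => max (t - q.1) (t - T : ℝ))
      (by fun_prop) continuous_snd fun q => lt_max_of_lt_right hε)
  have hFb : ∀ s x, |F s x| ≤ 4 * (2 * h ^ 2 * ((t : ℝ) - T)⁻¹) := fun s x => by
    rw [hF, abs_mul, abs_of_pos (by norm_num : (0 : ℝ) < 4)]
    refine mul_le_mul_of_nonneg_left ((abs_kernelDiff_le hh (lt_max_of_lt_right hε) x).trans ?_)
      (by norm_num)
    gcongr
    exact le_max_right _ _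
  have e : (fun p : Ω × ℝ => if p.2 ≤ T then
      ∫ u in (0 : ℝ)..p.2, F p.2 (B p.2.toNNReal p.1 - B u.toNNReal p.1) else 0)
      = fun p : Ω × ℝ => if p.2 ≤ T then uHat B t h p.2 p.1 else 0 := by
    funext p
    split_ifs with hp
    · simp only [hF]
      rw [intervalIntegral.integral_const_mul, uHat_eq, max_eq_left (by linarith)]
    · rfl
  obtain ⟨V, hV1, hV2⟩ := exists_simpleProcess_tendsto_pathIntegral hBm hB hFc hFb (t := t) hT
  rw [e] at hV1
  refine ⟨V, hV1, ?_⟩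
  have e' : ∀ p : Ω × ℝ, (if p.2 ≤ T then
      ∫ u in (0 : ℝ)..p.2, F p.2 (B p.2.toNNReal p.1 - B u.toNNReal p.1) else 0)
      = if p.2 ≤ T then uHat B t h p.2 p.1 else 0 := fun p => congrFun e p
  simpa only [e'] using hV2

lemma memLp_uHat [IsProbabilityMeasure P] (hBm : ∀ s, Measurable (B s)) (hB : IsBrownianReal B P)
    (t : ℝ≥0) {h : ℝ} (hh : 0 < h) :
    MemLp (fun p : Ω × ℝ => uHat B t h p.2 p.1) 2
      (P.prod (volume.restrict (Set.Icc 0 (t : ℝ)))) := by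
  obtain ⟨C, _, H⟩ := exists_lintegral_enorm_uHat_sq_le hBm hB t
  refine ⟨(H h hh).1, ?_⟩
  rw [eLpNorm_two_eq]
  exact ENNReal.rpow_lt_top_of_nonneg (by norm_num)
    ((H h hh).2.trans_lt ENNReal.ofReal_lt_top).ne

/-- The process is truncated at T_k ↑ t; the truncation error tends to zero by dominated
convergence, with `uHat` itself as dominating function, and each truncation is approximated by
simple processes. -/
lemma exists_simpleProcess_eLpNorm_sub_uHat_lt [IsProbabilityMeasure P]
    (hBm : ∀ s, Measurable (B s)) (hB : IsBrownianReal B P) {h : ℝ} (hh : 0 < h) {t : ℝ≥0}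
    (ht : 0 < t) {ε : ℝ≥0∞} (hε : 0 < ε) :
    ∃ V : SimpleProcess (generatedFiltration hBm),
      eLpNorm (fun p : Ω × ℝ => V.eval p.2 p.1 - uHat B t h p.2 p.1) 2
        (P.prod (volume.restrict (Set.Icc 0 (t : ℝ)))) < ε := by
  set ν := P.prod (volume.restrict (Set.Icc 0 (t : ℝ))) with hν
  have hu := memLp_uHat hBm hB t hh
  obtain ⟨T, _, hT, hTlim⟩ := exists_seq_strictMono_tendsto' ht
  choose V hVm hV using fun k => exists_simpleProcess_tendsto_uHat_truncated hBm hB hh.le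
    (hT k).1 (hT k).2
  set Y : ℕ → Ω × ℝ → ℝ := fun k p => if p.2 ≤ T k then uHat B t h p.2 p.1 else 0 with hY
  have hlt : ∀ᵐ p ∂ν, p.2 < (t : ℝ) := by
    have h0 : ∀ᵐ s ∂(volume.restrict (Set.Icc 0 (t : ℝ))), s < (t : ℝ) := by
      have hne : ∀ᵐ s ∂(volume.restrict (Set.Icc 0 (t : ℝ))), s ≠ (t : ℝ) :=
        ae_restrict_of_ae (by simp [ae_iff])
      filter_upwards [ae_restrict_mem measurableSet_Icc, hne] with s hs hs0
      exact lt_of_le_of_ne hs.2 hs0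
    exact Measure.quasiMeasurePreserving_snd.ae h0
  have htrunc : Tendsto (fun k => eLpNorm (fun p => Y k p - uHat B t h p.2 p.1) 2 ν) atTop
      (𝓝 0) := by
    refine tendsto_eLpNorm_two_zero_of_dominated (fun k => (hVm k).sub hu.1) hu
      (fun k => Eventually.of_forall fun p => ?_) ?_
    · by_cases hp : p.2 ≤ T k <;> simp [hY, hp]
    · filter_upwards [hlt] with p hp
      have hev : ∀ᶠ k in atTop, p.2 < T k :=
        (NNReal.tendsto_coe.2 hTlim).eventually (lt_mem_nhds hp)
      refine tendsto_const_nhds.congr' ?_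
      filter_upwards [hev] with k hk
      simp [hY, hk.le]
  have hε2 : 0 < ε / 2 := ENNReal.half_pos hε.ne'
  obtain ⟨k, hk⟩ := (htrunc.eventually (gt_mem_nhds hε2)).exists
  obtain ⟨n, hn⟩ := ((hV k).eventually (gt_mem_nhds hε2)).exists
  refine ⟨V k n, ?_⟩
  calc eLpNorm (fun p : Ω × ℝ => (V k n).eval p.2 p.1 - uHat B t h p.2 p.1) 2 ν
      = eLpNorm ((fun p : Ω × ℝ => (V k n).eval p.2 p.1 - Y k p) +
          fun p => Y k p - uHat B t h p.2 p.1) 2 ν := by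
        congr 1
        ext p
        simp
    _ ≤ _ := eLpNorm_add_le
        ((V k n).measurable_eval.aestronglyMeasurable.sub (hVm k)) ((hVm k).sub hu.1) (by norm_num)
    _ < ε / 2 + ε / 2 := ENNReal.add_lt_add hn hk
    _ = ε := ENNReal.add_halves ε

/-- A process in the `L²` closure of the simple processes has an Itô integral. -/
lemma exists_isItoIntegral [IsProbabilityMeasure P] (hBm : ∀ s, Measurable (B s))
    (hB : IsPreBrownianReal B P) {t : ℝ≥0} {u : ℝ → Ω → ℝ}
    (hu : MemLp (fun p : Ω × ℝ => u p.2 p.1) 2 (P.prod (volume.restrict (Set.Icc 0 (t : ℝ)))))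
    (happ : ∀ ε : ℝ≥0∞, 0 < ε → ∃ V : SimpleProcess (generatedFiltration hBm),
      eLpNorm (fun p : Ω × ℝ => V.eval p.2 p.1 - u p.2 p.1) 2
        (P.prod (volume.restrict (Set.Icc 0 (t : ℝ)))) < ε) :
    ∃ X : Ω → ℝ, IsItoIntegral (generatedFiltration hBm) B P t u X := by
  set ν := P.prod (volume.restrict (Set.Icc 0 (t : ℝ))) with hν
  have hpos : ∀ k : ℕ, (0 : ℝ≥0∞) < 2⁻¹ ^ (k + 1) := fun k =>
    ENNReal.pow_pos (by norm_num) _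
  -- The radius 2^(-(k+1)) makes two errors with index at least N add up to less than 2^(-N), a
  -- summable bound as the completeness of L² is used.
  choose V hV using fun k : ℕ => happ (2⁻¹ ^ (k + 1)) (hpos k)
  have hVm : ∀ k, AEStronglyMeasurable (fun p : Ω × ℝ => (V k).eval p.2 p.1) ν := fun k =>
    (V k).measurable_eval.aestronglyMeasurable
  have hcau : ∀ N n m : ℕ, N ≤ n → N ≤ m →
      eLpNorm ((V n).integral B t - (V m).integral B t) 2 P < 2⁻¹ ^ N := by
    intro N n m hn hm
    have hle : ∀ k, N ≤ k → (2⁻¹ : ℝ≥0∞) ^ (k + 1) ≤ 2⁻¹ ^ (N + 1) := fun k hk =>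
      pow_le_pow_of_le_one (by simp) (by norm_num) (by omega)
    calc eLpNorm ((V n).integral B t - (V m).integral B t) 2 P
        = eLpNorm (fun p : Ω × ℝ => (V n).eval p.2 p.1 - (V m).eval p.2 p.1) 2 ν :=
          SimpleProcess.eLpNorm_integral_sub hBm hB (V n) (V m) t
      _ = eLpNorm ((fun p : Ω × ℝ => (V n).eval p.2 p.1 - u p.2 p.1) -
            fun p : Ω × ℝ => (V m).eval p.2 p.1 - u p.2 p.1) 2 ν := by
          congr 1
          ext p
          simp
      _ ≤ _ := eLpNorm_sub_le ((hVm n).sub hu.1) ((hVm m).sub hu.1) (by norm_num)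
      _ < 2⁻¹ ^ (N + 1) + 2⁻¹ ^ (N + 1) :=
          ENNReal.add_lt_add ((hV n).trans_le (hle n hn)) ((hV m).trans_le (hle m hm))
      _ = 2⁻¹ ^ N := by
          rw [pow_succ, ← mul_add, ENNReal.inv_two_add_inv_two, mul_one]
  obtain ⟨X, hX, hlim⟩ := Lp.cauchy_complete_eLpNorm (p := 2) (by norm_num)
    (fun k => (V k).memLp_integral hB t) (B := fun N => 2⁻¹ ^ N)
    (by rw [ENNReal.tsum_geometric]; simp) hcau
  refine ⟨X, hu, hX, V, ?_, hlim⟩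
  have h0 : Tendsto (fun k : ℕ => (2⁻¹ : ℝ≥0∞) ^ (k + 1)) atTop (𝓝 0) :=
    (ENNReal.tendsto_pow_atTop_nhds_zero_of_lt_one (by norm_num)).comp (tendsto_add_atTop_nat 1)
  exact tendsto_of_tendsto_of_tendsto_of_le_of_le tendsto_const_nhds h0
    (fun _ => zero_le) fun k => (hV k).le

/-- The **Itô isometry**. -/
lemma IsItoIntegral.eLpNorm_eq [IsProbabilityMeasure P] {hBm : ∀ s, Measurable (B s)}
    (hB : IsPreBrownianReal B P) {t : ℝ≥0} {u : ℝ → Ω → ℝ} {X : Ω → ℝ}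
    (h : IsItoIntegral (generatedFiltration hBm) B P t u X) :
    eLpNorm X 2 P = eLpNorm (fun p : Ω × ℝ => u p.2 p.1) 2
      (P.prod (volume.restrict (Set.Icc 0 (t : ℝ)))) := by
  obtain ⟨hu, hX, V, hVu, hVX⟩ := h
  have h1 := tendsto_eLpNorm_of_tendsto_sub
    (fun k => (V k).measurable_eval.aestronglyMeasurable) hu hVu
  have h2 := tendsto_eLpNorm_of_tendsto_sub (fun k => ((V k).memLp_integral hB t).1) hX hVX
  simp_rw [fun k => SimpleProcess.eLpNorm_integral hBm hB (V k) t] at h2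
  exact tendsto_nhds_unique h2 h1

lemma integral_uHat_sq_le [IsProbabilityMeasure P] {t : ℝ≥0} {h K : ℝ} (hK : 0 ≤ K)
    (hu : MemLp (fun p : Ω × ℝ => uHat B t h p.2 p.1) 2
      (P.prod (volume.restrict (Set.Icc 0 (t : ℝ)))))
    (hle : ∫⁻ p : Ω × ℝ, ‖uHat B t h p.2 p.1‖ₑ ^ 2 ∂(P.prod (volume.restrict (Set.Icc 0 (t : ℝ))))
      ≤ ENNReal.ofReal K) :
    ∫ ω, (∫ r in (0 : ℝ)..t, |uHat B t h r ω| ^ 2) ∂P ≤ K := by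
  have hint : Integrable (fun p : Ω × ℝ => |uHat B t h p.2 p.1| ^ 2)
      (P.prod (volume.restrict (Set.Icc 0 (t : ℝ)))) := by
    simpa using hu.integrable_norm_pow two_ne_zero
  have e : ∀ ω, ∫ r in (0 : ℝ)..t, |uHat B t h r ω| ^ 2
      = ∫ r in Set.Icc 0 (t : ℝ), |uHat B t h r ω| ^ 2 := fun ω => by
    rw [intervalIntegral.integral_of_le (NNReal.coe_nonneg t), integral_Icc_eq_integral_Ioc]
  simp_rw [e]
  rw [← integral_prod (fun p : Ω × ℝ => |uHat B t h p.2 p.1| ^ 2) hint,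
    integral_eq_lintegral_of_nonneg_ae (Eventually.of_forall fun p => by positivity) hint.1]
  refine ENNReal.toReal_le_of_le_ofReal hK ((le_of_eq ?_).trans hle)
  refine lintegral_congr fun p => ?_
  rw [ENNReal.ofReal_pow (abs_nonneg _), Real.enorm_eq_ofReal_abs]

end LocalTimeModulus

theorem proposition2 {Ω : Type*} {mΩ : MeasurableSpace Ω} (P : Measure Ω) [IsProbabilityMeasure P]
    (B : ℝ≥0 → Ω → ℝ) (hBm : ∀ s, Measurable (B s)) (hB : IsBrownianReal B P)
    (t : ℝ≥0) (ht : 0 < t) :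
    -- the moment estimate, together with the square integrability that gives it a meaning
    (∃ C : ℝ, 0 < C ∧ ∀ h : ℝ, 0 < h →
      MemLp (fun p : Ω × ℝ => LocalTimeModulus.uHat B t h p.2 p.1) 2
        (P.prod (volume.restrict (Set.Icc 0 (t : ℝ)))) ∧
      ∫ ω, (∫ r in (0 : ℝ)..t, |LocalTimeModulus.uHat B t h r ω| ^ 2) ∂P ≤ C * h ^ 4) ∧
    -- the Itô integral of `uHat` over `[0, t]` exists
    (∀ h : ℝ, 0 < h → ∃ X : Ω → ℝ, LocalTimeModulus.IsItoIntegral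
      (Filtration.natural B (fun s => (hBm s).stronglyMeasurable)) B P t
      (LocalTimeModulus.uHat B t h) X) ∧
    -- and, multiplied by `h ^ (-3/2)`, it converges to zero in `L²(Ω)` as `h ↓ 0`
    (∀ X : ℝ → Ω → ℝ,
      (∀ h : ℝ, 0 < h → LocalTimeModulus.IsItoIntegral
        (Filtration.natural B (fun s => (hBm s).stronglyMeasurable)) B P t
        (LocalTimeModulus.uHat B t h) (X h)) →
      Tendsto (fun h : ℝ => eLpNorm (fun ω => h ^ (-(3 / 2) : ℝ) * X h ω) 2 P)
        (𝓝[>] 0) (𝓝 0)) := by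
  obtain ⟨C, hC, H⟩ := LocalTimeModulus.exists_lintegral_enorm_uHat_sq_le hBm hB t
  refine ⟨⟨C, hC, fun h hh => ?_⟩, fun h hh => ?_, fun X hX => ?_⟩
  · have hu := LocalTimeModulus.memLp_uHat hBm hB t hh
    exact ⟨hu, LocalTimeModulus.integral_uHat_sq_le (by positivity) hu (H h hh).2⟩
  · exact LocalTimeModulus.exists_isItoIntegral hBm hB.toIsPreBrownianReal
      (LocalTimeModulus.memLp_uHat hBm hB t hh) fun ε hε =>
        LocalTimeModulus.exists_simpleProcess_eLpNorm_sub_uHat_lt hBm hB hh ht hε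
  -- By the isometry any version of the integral has norm at most √C h², and h^(-3/2) h² = h^(1/2).
  · have hbound : ∀ h : ℝ, 0 < h → eLpNorm (fun ω => h ^ (-(3 / 2) : ℝ) * X h ω) 2 P
        ≤ ENNReal.ofReal (√C * h ^ (1 / 2 : ℝ)) := by
      intro h hh
      have h1 : eLpNorm (X h) 2 P ≤ ENNReal.ofReal (√C * h ^ 2) := by
        rw [LocalTimeModulus.IsItoIntegral.eLpNorm_eq (hBm := hBm) hB.toIsPreBrownianReal (hX h hh),
          LocalTimeModulus.eLpNorm_two_eq]
        calc _ ≤ ENNReal.ofReal (C * h ^ 4) ^ (1 / 2 : ℝ) :=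
              ENNReal.rpow_le_rpow (H h hh).2 (by norm_num)
          _ = _ := by
              rw [ENNReal.ofReal_rpow_of_nonneg (by positivity) (by norm_num),
                ← Real.sqrt_eq_rpow, Real.sqrt_mul hC.le, show h ^ 4 = (h ^ 2) ^ 2 by ring,
                Real.sqrt_sq (by positivity)]
      have h2 : eLpNorm (fun ω => h ^ (-(3 / 2) : ℝ) * X h ω) 2 P
          = ENNReal.ofReal (h ^ (-(3 / 2) : ℝ)) * eLpNorm (X h) 2 P := by
        have := eLpNorm_const_smul (h ^ (-(3 / 2) : ℝ)) (X h) 2 P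
        rw [Real.enorm_eq_ofReal (by positivity)] at this
        exact this
      rw [h2]
      calc _ ≤ ENNReal.ofReal (h ^ (-(3 / 2) : ℝ)) * ENNReal.ofReal (√C * h ^ 2) := by gcongr
        _ = _ := by
            rw [← ENNReal.ofReal_mul (by positivity), mul_left_comm,
              ← Real.rpow_natCast h 2, ← Real.rpow_add hh]
            norm_num
    have hlim : Tendsto (fun h : ℝ => ENNReal.ofReal (√C * h ^ (1 / 2 : ℝ))) (𝓝[>] 0) (𝓝 0) := by
      have hc : Continuous fun h : ℝ => ENNReal.ofReal (√C * h ^ (1 / 2 : ℝ)) :=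
        ENNReal.continuous_ofReal.comp
          (continuous_const.mul (Real.continuous_rpow_const (by norm_num)))
      have := (hc.tendsto 0).mono_left (nhdsWithin_le_nhds (s := Set.Ioi 0))
      simpa using this
    refine tendsto_of_tendsto_of_tendsto_of_le_of_le' tendsto_const_nhds hlim
      (Eventually.of_forall fun _ => zero_le) ?_
    filter_upwards [self_mem_nhdsWithin] with h hh using hbound h hh
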